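/- **Theorem (Well-posedness with neutrality).** Fix a real number $s\ge 2$, $k\in\{1,-1\}$ and $\nu\ge 0$. Let $c=c(t,x)$ be a continuous background state on $[0,\infty)\times\mathbb R$ with $0<c_-\le c(t,x)\le c_+$ for constants $c_\pm$, and assume $$\partial_t c\in L^\infty(\mathbb R_+;H^s\cap\dot H^{-1}\cap L^1(\mathbb R)),\qquad \partial_x c\in L^\infty(\mathbb R_+;H^s(\mathbb R)).$$ Put $c_0=c(0,\cdot)$, and let $\rho_0,u_0:\mathbb R\to\mathbb R$ (taken as their continuous representatives) satisfy $$(\rho_0-c_0,\;u_0)\in \big(H^s\cap\dot H^{-1}\cap L^1(\mathbb R)\big)\times\big(H^{s+1}\cap BV(\mathbb R)\big),$$ where $u_0\in BV(\mathbb R)$ means that $u_0$ has finite total variation on $\mathbb R$. Then there are $T>0$ and functions $\rho,u$ of class $\mathcal C^1$ on $[0,T)\times\mathbb R$ (that is, $f,\partial_tf,\partial_xf$ are continuous on $[0,T)\times\mathbb R$, and bounded on $[0,T']\times\mathbb R$ for every $T'<T$, for $f=\rho,u$) such that $(\rho,u)(0,\cdot)=(\rho_0,u_0)$, the Euler–Poisson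 system $$\partial_t\rho+\partial_x(\rho u)=0,\qquad \partial_tu+u\,\partial_xu=-\nu u-k\,\partial_x\phi,\qquad -\partial_{xx}\phi=\rho-c$$ holds at every point of $[0,T)\times\mathbb R$ for some potential $\phi$ with $\partial_x\phi(t,\cdot)\in L^2(\mathbb R)$ for all $t\in[0,T)$, the neutrality condition $$\rho(t,\cdot)-c(t,\cdot)\in L^1(\mathbb R),\qquad \int_{\mathbb R}(\rho(t,x)-c(t,x))\,dx=0\qquad\text{for all }t\in[0,T)$$ holds, and $$\sup_{0\le t<T}\Big(\|(\rho-c)(t)\|_{L^1}+\|(\partial_xu)(t)\|_{L^1}\Big)<\infty .$$ -/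

import Mathlib

open MeasureTheory Set
open scoped ENNReal NNReal FourierTransform

noncomputable section

/-- The (extended-valued) norm of `H^s(ℝ)`, `s ≥ 0`: the `L²` norm of `(1 + |ξ|²)^(s/2) f̂(ξ)`, where
`f̂` is the Plancherel Fourier transform of `f ∈ L²`. It is `∞` if `f ∉ L²`. -/
def sobolevENorm (s : ℝ) (f : ℝ → ℝ) : ℝ≥0∞ :=
  open Classical in
  if hf : MemLp (fun x => (f x : ℂ)) 2 (volume : Measure ℝ) then
    eLpNorm (fun ξ : ℝ => (((1 + |ξ| ^ 2) ^ (s / 2) : ℝ) : ℂ) *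
      (𝓕 (hf.toLp (fun x => (f x : ℂ))) : Lp ℂ 2 (volume : Measure ℝ)) ξ) 2 volume
  else ⊤

/-- The (extended-valued) norm of the homogeneous space `Ḣ^{-1}(ℝ)`, on functions `f ∈ L²(ℝ)`: the
`L²` norm of `|ξ|⁻¹ f̂(ξ)`. It is only used for the intersections `H^s ∩ Ḣ^{-1}` with `s ≥ 0`, so it
is set to `∞` if `f ∉ L²`. -/
def homSobolevNegOneENorm (f : ℝ → ℝ) : ℝ≥0∞ :=
  open Classical in
  if hf : MemLp (fun x => (f x : ℂ)) 2 (volume : Measure ℝ) then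
    eLpNorm (fun ξ : ℝ => ((|ξ|⁻¹ : ℝ) : ℂ) *
      (𝓕 (hf.toLp (fun x => (f x : ℂ))) : Lp ℂ 2 (volume : Measure ℝ)) ξ) 2 volume
  else ⊤

/-- Background states `c(t,x)`, `t ≥ 0`, `x ∈ ℝ`: continuous, with values in `[c₋, c₊]`,
`c₋ > 0`, such that `∂ₜc ∈ L^∞(ℝ₊; H^s ∩ Ḣ^{-1} ∩ L¹)` and `∂ₓc ∈ L^∞(ℝ₊; H^s)`. The time derivative
is understood in the integrated (weak) sense: `ct` represents it when
`c(t,x) = c(0,x) + ∫₀ᵗ ct(τ,x) dτ`. -/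
structure IsBackground (s cmin cmax : ℝ) (c : ℝ → ℝ → ℝ) : Prop where
  cmin_pos : 0 < cmin
  lower : ∀ t, 0 ≤ t → ∀ x, cmin ≤ c t x
  upper : ∀ t, 0 ≤ t → ∀ x, c t x ≤ cmax
  continuousOn : ContinuousOn (Function.uncurry c) (Ici 0 ×ˢ univ)
  time_deriv : ∃ ct : ℝ → ℝ → ℝ, Measurable (Function.uncurry ct) ∧
    (∀ t, 0 ≤ t → ∀ᵐ x, IntervalIntegrable (fun τ => ct τ x) volume 0 t ∧
      c t x = c 0 x + ∫ τ in (0 : ℝ)..t, ct τ x) ∧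
    ∃ M : ℝ≥0, ∀ᵐ t ∂(volume.restrict (Ici (0 : ℝ))),
      sobolevENorm s (ct t) ≤ M ∧ homSobolevNegOneENorm (ct t) ≤ M ∧
        eLpNorm (ct t) 1 volume ≤ M
  space_deriv : ∃ M : ℝ≥0, ∀ᵐ t ∂(volume.restrict (Ici (0 : ℝ))),
    Differentiable ℝ (c t) ∧ sobolevENorm s (deriv (c t)) ≤ M

/-- The time derivative on `[0,T)` (one-sided at `t = 0`). -/
def timeDeriv (T : ℝ) (f : ℝ → ℝ → ℝ) (t x : ℝ) : ℝ :=
  derivWithin (fun τ => f τ x) (Ico 0 T) t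

/-- The space derivative. -/
def spaceDeriv (f : ℝ → ℝ → ℝ) (t x : ℝ) : ℝ :=
  deriv (f t) x

/-- Functions of class `C¹` on `[0,T) × ℝ`: `f`, `∂ₜf`, `∂ₓf` exist and are continuous, and
`|f| + |∂ₜf| + |∂ₓf|` is bounded on `[0,T'] × ℝ` for every `T' < T`. -/
structure IsClassC1 (T : ℝ) (f : ℝ → ℝ → ℝ) : Prop where
  diff_time : ∀ t ∈ Ico 0 T, ∀ x, DifferentiableWithinAt ℝ (fun τ => f τ x) (Ico 0 T) t
  diff_space : ∀ t ∈ Ico 0 T, Differentiable ℝ (f t)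
  cont : ContinuousOn (Function.uncurry f) (Ico 0 T ×ˢ univ)
  cont_time : ContinuousOn (Function.uncurry (timeDeriv T f)) (Ico 0 T ×ˢ univ)
  cont_space : ContinuousOn (Function.uncurry (spaceDeriv f)) (Ico 0 T ×ˢ univ)
  bounded : ∀ T' ∈ Ico 0 T, ∃ B : ℝ, ∀ t ∈ Icc 0 T', ∀ x,
    |f t x| + |timeDeriv T f t x| + |spaceDeriv f t x| ≤ B

/-- Classical solutions `(ρ,u)` on `[0,T) × ℝ`: class `C¹`, the Euler--Poisson system holds pointwise
with a potential `φ`, the initial data are attained, and the neutrality condition holds. The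
condition `∂ₓφ(t,·) ∈ L²` says that the force is the one associated with `ρ - c ∈ Ḣ^{-1}`, so that
`∂ₓφ` is determined by the Poisson equation. -/
structure IsClassicalSolution (k ν : ℝ) (c : ℝ → ℝ → ℝ) (ρ₀ u₀ : ℝ → ℝ) (T : ℝ)
    (ρ u : ℝ → ℝ → ℝ) : Prop where
  density_C1 : IsClassC1 T ρ
  velocity_C1 : IsClassC1 T u
  continuity_eq : ∀ t ∈ Ico 0 T, ∀ x,
    timeDeriv T ρ t x + spaceDeriv (fun τ y => ρ τ y * u τ y) t x = 0
  momentum_poisson : ∃ φ : ℝ → ℝ → ℝ, ∀ t ∈ Ico 0 T,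
    Differentiable ℝ (φ t) ∧ Differentiable ℝ (spaceDeriv φ t) ∧
    MemLp (spaceDeriv φ t) 2 volume ∧
    (∀ x, -spaceDeriv (spaceDeriv φ) t x = ρ t x - c t x) ∧
    ∀ x, timeDeriv T u t x + u t x * spaceDeriv u t x
      = -ν * u t x - k * spaceDeriv φ t x
  initial_density : ∀ x, ρ 0 x = ρ₀ x
  initial_velocity : ∀ x, u 0 x = u₀ x
  neutrality : ∀ t ∈ Ico 0 T,
    Integrable (fun x => ρ t x - c t x) volume ∧ ∫ x, (ρ t x - c t x) = 0

end

open MeasureTheory Set Filter Topology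
open scoped ENNReal NNReal FourierTransform Interval

/-!
Follow the particles: let `X t a` be the position at time `t` of the particle that starts at `a`,
and `U t a` its velocity. With `Γ` and `m` suitably normalised primitives in `x` of `c` and of `ρ₀`,
conservation of mass makes the field `∂ₓφ` along a trajectory equal to `Γ t (X t a) - m a`, so the
system decouples into ordinary differential equations `X' = U`, `U' = -ν U - k (Γ t X - m a)`, one
for each label `a`. For a short time `∂ₐX` stays close to `1`, the flow can be inverted, and the
density `ρ₀ / ∂ₐX` and the velocity `U`, read off at the label of the particle sitting at `x`, solve
the Euler-Poisson system.

The `Ḣ⁻¹` hypotheses put the initial field `Γ 0 - m` and the increments `Γ t - Γ 0` in `L²`. The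
field then remains in `L²` along the flow, and an integrable function with a primitive in `L²` has
integral zero: this is neutrality.
-/

/-- The projection of the line onto `[a, b]`. Unlike `Set.projIcc` it takes real values and does not
depend on a proof of `a ≤ b`. -/
def clamp (a b t : ℝ) : ℝ := max a (min b t)

theorem continuous_clamp (a b : ℝ) : Continuous (clamp a b) := by
  unfold clamp; fun_prop

theorem clamp_mem_Icc {a b : ℝ} (h : a ≤ b) (t : ℝ) : clamp a b t ∈ Icc a b :=
  ⟨le_max_left _ _, max_le h (min_le_left _ _)⟩

theorem clamp_of_mem {a b t : ℝ} (ht : t ∈ Icc a b) : clamp a b t = t := by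
  rw [clamp, min_eq_right ht.2, max_eq_right ht.1]

theorem isPicardLindelof_of_lipschitzWith {E : Type*} [NormedAddCommGroup E]
    {f : ℝ → E → E} {K A : ℝ≥0} {y₀ : E} {T : ℝ}
    (hf : ∀ x, Continuous fun t => f t x) (hlip : ∀ t, LipschitzWith K (f t)) (hT : 0 ≤ T)
    (hKT : K * T ≤ 1 / 2) (hA : ∀ t ∈ Icc (-T) T, ‖f t y₀‖ ≤ A) :
    IsPicardLindelof f (⟨0, by linarith, hT⟩ : Icc (-T) T) y₀ (2 * A * T.toNNReal) 0
      (A + K * (2 * A * T.toNNReal)) K where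
  lipschitzOnWith t _ := (hlip t).lipschitzOnWith
  continuousOn x _ := (hf x).continuousOn
  norm_le t ht x hx := by
    rw [Metric.mem_closedBall, dist_eq_norm] at hx
    push_cast at hx ⊢
    exact (norm_le_norm_add_norm_sub' _ (f t y₀)).trans
      (add_le_add (hA t ht) (((hlip t).norm_sub_le x y₀).trans (by gcongr)))
  mul_max_le := by
    push_cast [Real.coe_toNNReal T hT]
    rw [sub_zero, zero_sub, neg_neg, max_self]
    nlinarith [mul_le_mul_of_nonneg_left hKT (mul_nonneg A.coe_nonneg hT),
      mul_nonneg A.coe_nonneg hT]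

/-! ### Ordinary differential equations on `[-T, T]` -/

section Curves

variable {E F : Type*} [NormedAddCommGroup E] [NormedSpace ℝ E] [NormedAddCommGroup F]
  [NormedSpace ℝ F] {T t : ℝ} {y v z w : ℝ → E}

theorem uIcc_zero_clamp_subset (hT : 0 ≤ T) (t : ℝ) : [[0, clamp (-T) T t]] ⊆ Icc (-T) T :=
  uIcc_subset_Icc ⟨by linarith, hT⟩ (clamp_mem_Icc (by linarith) t)

/-- The curve `y` is the primitive of the continuous velocity `v` on `[-T, T]` and is constant on
each side of this interval. Freezing the curve outside `[-T, T]` makes it continuous and bounded on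
the whole time axis, and `y` differentiable on the open interval, `0` included. -/
structure HasVelocityOn (T : ℝ) (y v : ℝ → E) : Prop where
  continuous_velocity : Continuous v
  eq_add_integral : ∀ t, y t = y 0 + ∫ τ in (0 : ℝ)..clamp (-T) T t, v τ

namespace HasVelocityOn

theorem continuous (h : HasVelocityOn T y v) : Continuous y := by
  rw [funext h.eq_add_integral]
  exact continuous_const.add
    ((intervalIntegral.continuous_primitive
      (fun _ _ => h.continuous_velocity.intervalIntegrable _ _) 0).comp (continuous_clamp (-T) T))

theorem hasDerivAt [CompleteSpace E] (h : HasVelocityOn T y v) (ht : t ∈ Ioo (-T) T) :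
    HasDerivAt y (v t) t := by
  refine ((h.continuous_velocity.integral_hasStrictDerivAt 0 t).hasDerivAt.const_add
    (y 0)).congr_of_eventuallyEq ?_
  filter_upwards [isOpen_Ioo.mem_nhds ht] with τ hτ
  rw [h.eq_add_integral, clamp_of_mem (Ioo_subset_Icc_self hτ)]

theorem sub (hy : HasVelocityOn T y v) (hz : HasVelocityOn T z w) :
    HasVelocityOn T (fun t => y t - z t) fun t => v t - w t where
  continuous_velocity := hy.continuous_velocity.sub hz.continuous_velocity
  eq_add_integral t := by
    rw [intervalIntegral.integral_sub (hy.continuous_velocity.intervalIntegrable _ _)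
      (hz.continuous_velocity.intervalIntegrable _ _), hy.eq_add_integral t, hz.eq_add_integral t]
    abel

theorem const (c : E) : HasVelocityOn T (fun _ => c) fun _ => 0 where
  continuous_velocity := continuous_const
  eq_add_integral t := by simp

theorem clm_comp [CompleteSpace E] [CompleteSpace F] (h : HasVelocityOn T y v) (L : E →L[ℝ] F) :
    HasVelocityOn T (fun t => L (y t)) fun t => L (v t) where
  continuous_velocity := L.continuous.comp h.continuous_velocity
  eq_add_integral t := by
    rw [L.intervalIntegral_comp_comm (h.continuous_velocity.intervalIntegrable _ _), ← map_add,
      ← h.eq_add_integral]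

theorem eq_clamp (h : HasVelocityOn T y v) (hT : 0 ≤ T) (t : ℝ) : y t = y (clamp (-T) T t) := by
  rw [h.eq_add_integral t, h.eq_add_integral (clamp (-T) T t),
    clamp_of_mem (clamp_mem_Icc (neg_le_self hT) t)]

theorem comp_left {y v f f' : ℝ → ℝ} (h : HasVelocityOn T y v) (hT : 0 ≤ T)
    (hf : ∀ x, HasDerivAt f (f' x) x) (hf' : Continuous f') :
    HasVelocityOn T (fun t => f (y t)) fun t => f' (y t) * v t := by
  have hfc : Continuous f := continuous_iff_continuousAt.2 fun x => (hf x).continuousAt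
  have hvel : Continuous fun t => f' (y t) * v t :=
    (hf'.comp h.continuous).mul h.continuous_velocity
  refine ⟨hvel, fun t => ?_⟩
  have hsub := interior_mono (uIcc_zero_clamp_subset hT t)
  rw [uIcc, interior_Icc, interior_Icc] at hsub
  rw [intervalIntegral.integral_eq_sub_of_hasDeriv_right (hfc.comp h.continuous).continuousOn
    (fun τ hτ => ((hf _).comp τ (h.hasDerivAt (hsub hτ))).hasDerivWithinAt)
    (hvel.intervalIntegrable _ _), Function.comp_apply, Function.comp_apply, add_sub_cancel,
    ← h.eq_clamp hT]

theorem norm_sub_le (h : HasVelocityOn T y v) (hT : 0 ≤ T) {C : ℝ} (hC : 0 ≤ C) {b : ℝ → ℝ}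
    (hb : Continuous b) (hb0 : ∀ t, 0 ≤ b t) (hv : ∀ t ∈ Icc (-T) T, ‖v t‖ ≤ C + b t) (t : ℝ) :
    ‖y t - y 0‖ ≤ C * T + ∫ τ in -T..T, b τ := by
  have hsub := uIcc_zero_clamp_subset hT t
  have hlen : |clamp (-T) T t| ≤ T := abs_le.2 (clamp_mem_Icc (neg_le_self hT) t)
  calc ‖y t - y 0‖
    _ = ‖∫ τ in (0 : ℝ)..clamp (-T) T t, v τ‖ := by rw [h.eq_add_integral, add_sub_cancel_left]
    _ ≤ |∫ τ in (0 : ℝ)..clamp (-T) T t, (C + b τ)| :=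
        intervalIntegral.norm_integral_le_abs_of_norm_le
          (ae_restrict_of_forall_mem measurableSet_uIoc fun τ hτ =>
            hv τ (hsub (uIoc_subset_uIcc hτ)))
          ((continuous_const.add hb).intervalIntegrable _ _)
    _ = |C * clamp (-T) T t + ∫ τ in (0 : ℝ)..clamp (-T) T t, b τ| := by
        rw [intervalIntegral.integral_add (by simp) (hb.intervalIntegrable _ _)]
        simp [mul_comm]
    _ ≤ |C * clamp (-T) T t| + |∫ τ in (0 : ℝ)..clamp (-T) T t, b τ| := abs_add_le _ _
    _ ≤ C * T + |∫ τ in -T..T, b τ| := by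
        rw [abs_mul, abs_of_nonneg hC]
        refine add_le_add (mul_le_mul_of_nonneg_left hlen hC) ?_
        exact intervalIntegral.abs_integral_mono_interval
          (uIoc_subset_uIoc_of_uIcc_subset_uIcc
            (by rwa [uIcc_of_le (by linarith : -T ≤ T)]))
          (Eventually.of_forall hb0) (hb.intervalIntegrable _ _)
    _ = C * T + ∫ τ in -T..T, b τ := by
        rw [abs_of_nonneg (intervalIntegral.integral_nonneg (by linarith) fun τ _ => hb0 τ)]

/-- A short-time substitute for Grönwall's inequality, in both directions of time. -/
theorem norm_le_two_mul (h : HasVelocityOn T y v) (hT : 0 ≤ T) {K : ℝ} (hK : 0 ≤ K)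
    (hKT : K * T ≤ 1 / 2) {b : ℝ → ℝ} (hb : Continuous b) (hb0 : ∀ t, 0 ≤ b t)
    (hv : ∀ t ∈ Icc (-T) T, ‖v t‖ ≤ K * ‖y t‖ + b t) (t : ℝ) :
    ‖y t‖ ≤ 2 * (‖y 0‖ + ∫ τ in -T..T, b τ) := by
  obtain ⟨s, -, hmax⟩ : ∃ s ∈ Icc (-T) T, ∀ t ∈ Icc (-T) T, ‖y t‖ ≤ ‖y s‖ :=
    isCompact_Icc.exists_isMaxOn ⟨_, clamp_mem_Icc (neg_le_self hT) t⟩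
      h.continuous.norm.continuousOn
  have hsub := h.norm_sub_le hT (mul_nonneg hK (norm_nonneg (y s))) hb hb0
    (fun t ht => (hv t ht).trans (by gcongr; exact hmax t ht)) s
  have htri := norm_le_norm_add_norm_sub' (y s) (y 0)
  rw [h.eq_clamp hT t]
  refine (hmax _ (clamp_mem_Icc (neg_le_self hT) t)).trans ?_
  nlinarith [norm_nonneg (y s)]

end HasVelocityOn

theorem exists_hasVelocityOn [CompleteSpace E] {f : ℝ → E → E} {K : ℝ≥0}
    (hf : Continuous (Function.uncurry f)) (hlip : ∀ t, LipschitzWith K (f t)) (hT : 0 ≤ T)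
    (hKT : K * T ≤ 1 / 2) (y₀ : E) :
    ∃ y : ℝ → E, y 0 = y₀ ∧ HasVelocityOn T y fun t => f t (y t) := by
  obtain ⟨A, hA⟩ := isCompact_Icc.exists_bound_of_continuousOn (s := Icc (-T) T)
    (f := fun t => f t y₀) (by fun_prop)
  obtain ⟨α, hα0, hα⟩ := (isPicardLindelof_of_lipschitzWith (A := A.toNNReal) (fun x => by fun_prop)
    hlip hT hKT fun t ht => (hA t ht).trans A.le_coe_toNNReal)
    |>.exists_eq_forall_mem_Icc_hasDerivWithinAt (Metric.mem_closedBall_self le_rfl)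
  have hcont : ContinuousOn α (Icc (-T) T) := fun t ht => (hα t ht).continuousWithinAt
  have hzero : clamp (-T) T 0 = 0 := clamp_of_mem ⟨by linarith, hT⟩
  have hvel : Continuous fun t => f t (α (clamp (-T) T t)) :=
    hf.comp (continuous_id.prodMk
      (hcont.comp_continuous (continuous_clamp (-T) T) (clamp_mem_Icc (neg_le_self hT))))
  refine ⟨fun t => α (clamp (-T) T t), (congrArg α hzero).trans hα0, hvel, fun t => ?_⟩
  have hsub := uIcc_zero_clamp_subset hT t
  simp only [hzero]
  rw [intervalIntegral.integral_eq_sub_of_hasDeriv_right (hcont.mono hsub)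
    (fun τ hτ => ?_) (hvel.intervalIntegrable _ _), add_sub_cancel]
  have hmem : τ ∈ Icc (-T) T := hsub (Ioo_subset_Icc_self hτ)
  have hnhds : Icc (-T) T ∈ 𝓝[>] τ := mem_nhdsWithin_of_mem_nhds
    (mem_of_superset (isOpen_Ioo.mem_nhds hτ) (Ioo_subset_Icc_self.trans hsub))
  simpa only [clamp_of_mem hmem] using (hα τ hmem).mono_of_mem_nhdsWithin hnhds

theorem continuous_uncurry_of_hasVelocityOn {P : Type*} [TopologicalSpace P] {f : ℝ → P → E → E}
    {K : ℝ≥0} (hf : Continuous fun q : ℝ × P × E => f q.1 q.2.1 q.2.2)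
    (hlip : ∀ t p, LipschitzWith K (f t p)) (hT : 0 ≤ T) (hKT : K * T ≤ 1 / 2) {y : ℝ → P → E}
    (hy₀ : Continuous (y 0)) (hy : ∀ p, HasVelocityOn T (y · p) fun t => f t p (y t p)) :
    Continuous (Function.uncurry y) := by
  refine continuous_iff_continuousAt.2 fun ⟨t₀, p₀⟩ => ?_
  set b : P → ℝ → ℝ := fun p τ => ‖f τ p (y τ p₀) - f τ p₀ (y τ p₀)‖
  set δ : P → ℝ := fun p => 2 * (‖y 0 p - y 0 p₀‖ + ∫ τ in -T..T, b p τ)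
  have hy₀cont := (hy p₀).continuous
  have hb : Continuous (Function.uncurry b) := by
    simp only [b, Function.uncurry_def]
    fun_prop
  have hδ : Tendsto δ (𝓝 p₀) (𝓝 0) := by
    have hcont : Continuous δ := continuous_const.mul ((hy₀.sub continuous_const).norm.add
      (intervalIntegral.continuous_parametric_intervalIntegral_of_continuous' hb _ _))
    simpa [δ, b] using hcont.tendsto p₀
  have hle : ∀ t p, ‖y t p - y t p₀‖ ≤ δ p := fun t p =>
    ((hy p).sub (hy p₀)).norm_le_two_mul hT K.2 hKT (hb.uncurry_left p) (fun _ => norm_nonneg _)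
      (fun t _ => by
        have htri := norm_sub_le_norm_sub_add_norm_sub (f t p (y t p)) (f t p (y t p₀))
          (f t p₀ (y t p₀))
        exact htri.trans (add_le_add_left ((hlip t p).norm_sub_le _ _) _)) t
  refine tendsto_iff_norm_sub_tendsto_zero.2 (squeeze_zero (fun _ => norm_nonneg _)
    (fun q => (norm_sub_le_norm_sub_add_norm_sub _ (y q.1 p₀) _).trans
      (add_le_add_left (hle q.1 q.2) _)) ?_)
  have hlim : Tendsto (fun t => ‖y t p₀ - y t₀ p₀‖) (𝓝 t₀) (𝓝 0) :=
    tendsto_iff_norm_sub_tendsto_zero.1 (hy₀cont.tendsto t₀)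
  simpa using (hδ.comp (continuous_snd.tendsto (t₀, p₀))).add
    (hlim.comp (continuous_fst.tendsto (t₀, p₀)))

theorem integral_fderiv_segment [CompleteSpace F] {f : E → F} {f' : E → E →L[ℝ] F}
    (hf : ∀ x, HasFDerivAt f (f' x) x) (hf' : Continuous f') (x y : E) :
    ∫ θ in (0 : ℝ)..1, f' (x + θ • (y - x)) (y - x) = f y - f x := by
  have hline : ∀ θ : ℝ, HasDerivAt (fun θ : ℝ => f (x + θ • (y - x)))
      (f' (x + θ • (y - x)) (y - x)) θ := fun θ =>
    (hf _).comp_hasDerivAt θ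
      (by simpa using ((hasDerivAt_id θ).smul_const (y - x)).const_add x)
  rw [intervalIntegral.integral_eq_sub_of_hasDerivAt (fun θ _ => hline θ)
    (Continuous.intervalIntegrable (by fun_prop) _ _)]
  simp

/-- A field `G t (a, y)` depending on a real parameter `a`, of class `C¹` in `(a, y)` with
derivative `G'`, whose derivative in `y` is bounded by `K`. -/
structure IsParametricField (K : ℝ≥0) (G : ℝ → ℝ × E → E) (G' : ℝ → ℝ × E → ℝ × E →L[ℝ] E) :
    Prop where
  continuous : Continuous (Function.uncurry G)
  continuous_fderiv : Continuous (Function.uncurry G')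
  hasFDerivAt : ∀ t z, HasFDerivAt (G t) (G' t z) z
  norm_fderiv_inr_le : ∀ t z w, ‖G' t z (0, w)‖ ≤ K * ‖w‖

namespace IsParametricField

variable {K : ℝ≥0} {G : ℝ → ℝ × E → E} {G' : ℝ → ℝ × E → ℝ × E →L[ℝ] E}

theorem lipschitzWith (h : IsParametricField K G G') (t a : ℝ) :
    LipschitzWith K fun y => G t (a, y) := by
  refine lipschitzOnWith_univ.1 (convex_univ.lipschitzOnWith_of_nnnorm_hasFDerivWithin_le
    (f' := fun y => (G' t (a, y)).comp (.inr ℝ ℝ E)) (fun y _ => ?_) fun y _ => ?_)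
  · exact ((h.hasFDerivAt t (a, y)).comp y (hasFDerivAt_prodMk_right a y)).hasFDerivWithinAt
  · exact ContinuousLinearMap.opNorm_le_bound _ K.2 fun w => h.norm_fderiv_inr_le t (a, y) w

/-- The field driving the difference quotients `(y t a - y t b) / (a - b)` of a family of solutions:
the average of `G' t · (1, w)` over the segment joining the states of the labels `p = (b, a)`. It
depends continuously on the labels, also where they coincide. -/
noncomputable def slopeField (G' : ℝ → ℝ × E → ℝ × E →L[ℝ] E) (y : ℝ → ℝ → E) (t : ℝ)
    (p : ℝ × ℝ) (w : E) : E :=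
  ∫ θ in (0 : ℝ)..1,
    G' t ((p.1, y t p.1) + θ • ((p.2, y t p.2) - (p.1, y t p.1))) (1, w)

theorem continuous_slopeField (h : IsParametricField K G G') {y : ℝ → ℝ → E}
    (cy : Continuous (Function.uncurry y)) :
    Continuous fun q : ℝ × (ℝ × ℝ) × E => slopeField G' y q.1 q.2.1 q.2.2 := by
  have hG' := h.continuous_fderiv
  refine intervalIntegral.continuous_parametric_intervalIntegral_of_continuous' ?_ _ _
  simp only [Function.uncurry_def]
  fun_prop

theorem lipschitzWith_slopeField (h : IsParametricField K G G') (y : ℝ → ℝ → E) (t : ℝ)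
    (p : ℝ × ℝ) : LipschitzWith K (slopeField G' y t p) := by
  have hG' := h.continuous_fderiv
  refine LipschitzWith.of_dist_le_mul fun w w' => ?_
  rw [dist_eq_norm, dist_eq_norm, slopeField, slopeField, ← intervalIntegral.integral_sub
    (Continuous.intervalIntegrable (by fun_prop) _ _)
    (Continuous.intervalIntegrable (by fun_prop) _ _)]
  refine (intervalIntegral.norm_integral_le_of_norm_le_const (C := K * ‖w - w'‖)
    fun θ _ => ?_).trans (by simp)
  have hdiff : ((1 : ℝ), w) - (1, w') = (0, w - w') := by simp
  rw [← map_sub, hdiff]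
  exact h.norm_fderiv_inr_le _ _ _

variable [CompleteSpace E]

theorem norm_sub_sub_smul_slopeField_le (h : IsParametricField K G G') (y : ℝ → ℝ → E) (t a b : ℝ)
    (w : E) : ‖G t (a, y t a) - G t (b, y t b) - (a - b) • slopeField G' y t (b, a) w‖ ≤
      K * ‖y t a - y t b - (a - b) • w‖ := by
  have hG' := h.continuous_fderiv
  have hdir : ((a, y t a) - (b, y t b)) - (a - b) • ((1 : ℝ), w) =
      (0, y t a - y t b - (a - b) • w) := by simp
  rw [← integral_fderiv_segment (h.hasFDerivAt t) (by fun_prop), slopeField,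
    ← intervalIntegral.integral_smul, ← intervalIntegral.integral_sub
      (Continuous.intervalIntegrable (by fun_prop) _ _)
      (Continuous.intervalIntegrable (by fun_prop) _ _)]
  refine (intervalIntegral.norm_integral_le_of_norm_le_const
    (C := K * ‖y t a - y t b - (a - b) • w‖) fun θ _ => ?_).trans (by simp)
  rw [← map_smul, ← map_sub, hdir]
  exact h.norm_fderiv_inr_le _ _ _

theorem exists_hasVelocityOn (h : IsParametricField K G G') (hT : 0 ≤ T) (hKT : K * T ≤ 1 / 2)
    {y₀ : ℝ → E} (hy₀ : Continuous y₀) :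
    ∃ y : ℝ → ℝ → E, y 0 = y₀ ∧ Continuous (Function.uncurry y) ∧
      ∀ a, HasVelocityOn T (y · a) fun t => G t (a, y t a) := by
  have hG := h.continuous
  choose y hy₀' hy using fun a => _root_.exists_hasVelocityOn (f := fun t y => G t (a, y))
    (by fun_prop) (fun t => h.lipschitzWith t a) hT hKT (y₀ a)
  refine ⟨fun t a => y a t, funext hy₀', ?_, hy⟩
  exact continuous_uncurry_of_hasVelocityOn (f := fun t a y => G t (a, y)) (by fun_prop)
    h.lipschitzWith hT hKT (by rwa [funext hy₀']) hy

theorem exists_slope (h : IsParametricField K G G') (hT : 0 ≤ T) (hKT : K * T ≤ 1 / 2)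
    {y : ℝ → ℝ → E} {y₀' : ℝ → E} (cy : Continuous (Function.uncurry y))
    (hy₀ : ∀ a, HasDerivAt (y 0) (y₀' a) a) (cy₀' : Continuous y₀')
    (hy : ∀ a, HasVelocityOn T (y · a) fun t => G t (a, y t a)) :
    ∃ q : ℝ → ℝ × ℝ → E, Continuous (Function.uncurry q) ∧ (∀ a, q 0 (a, a) = y₀' a) ∧
      (∀ a, HasVelocityOn T (fun t => q t (a, a)) fun t => G' t (a, y t a) (1, q t (a, a))) ∧
      ∀ t a b, y t a - y t b = (a - b) • q t (b, a) := by
  have cf := h.continuous_slopeField cy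
  choose q hq₀ hq using fun p : ℝ × ℝ => _root_.exists_hasVelocityOn
    (f := fun t => slopeField G' y t p) (by fun_prop) (fun t => h.lipschitzWith_slopeField y t p)
    hT hKT (∫ θ in (0 : ℝ)..1, y₀' (p.1 + θ • (p.2 - p.1)))
  have cq₀ : Continuous fun p : ℝ × ℝ => q p 0 := by
    simp only [hq₀]
    exact intervalIntegral.continuous_parametric_intervalIntegral_of_continuous'
      (by simp only [Function.uncurry_def]; fun_prop) _ _
  refine ⟨fun t p => q p t, continuous_uncurry_of_hasVelocityOn cf
    (h.lipschitzWith_slopeField y) hT hKT cq₀ hq, fun a => by simp [hq₀], fun a => ?_,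
    fun t a b => ?_⟩
  · simpa [slopeField] using hq (a, a)
  have hinit : (y 0 a - y 0 b) - (a - b) • q (b, a) 0 = 0 := by
    rw [hq₀, intervalIntegral.integral_unitInterval_deriv_eq_sub
      (by fun_prop) (fun _ _ => hy₀ _), add_sub_cancel, sub_self]
  have hz := ((hy a).sub (hy b)).sub ((hq (b, a)).clm_comp ((a - b) • .id ℝ E))
  have hbound := hz.norm_le_two_mul hT K.2 hKT continuous_zero (fun _ => le_rfl)
    (fun τ _ => by simpa using h.norm_sub_sub_smul_slopeField_le y τ a b (q (b, a) τ)) t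
  simpa [hinit, sub_eq_zero] using hbound

theorem exists_hasDerivAt (h : IsParametricField K G G') (hT : 0 ≤ T) (hKT : K * T ≤ 1 / 2)
    {y : ℝ → ℝ → E} {y₀' : ℝ → E} (cy : Continuous (Function.uncurry y))
    (hy₀ : ∀ a, HasDerivAt (y 0) (y₀' a) a) (cy₀' : Continuous y₀')
    (hy : ∀ a, HasVelocityOn T (y · a) fun t => G t (a, y t a)) :
    ∃ D : ℝ → ℝ → E, D 0 = y₀' ∧ Continuous (Function.uncurry D) ∧
      (∀ t a, HasDerivAt (y t) (D t a) a) ∧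
      ∀ a, HasVelocityOn T (D · a) fun t => G' t (a, y t a) (1, D t a) := by
  obtain ⟨q, cq, hq₀, hqv, hslope⟩ := h.exists_slope hT hKT cy hy₀ cy₀' hy
  refine ⟨fun t a => q t (a, a), funext hq₀, by fun_prop, fun t b => ?_, hqv⟩
  have hlim : Tendsto (fun a => q t (b, a)) (𝓝[≠] b) (𝓝 (q t (b, b))) :=
    ((by fun_prop : Continuous fun a => q t (b, a)).tendsto b).mono_left nhdsWithin_le_nhds
  refine hasDerivAt_iff_tendsto_slope.2 (hlim.congr' ?_)
  filter_upwards [self_mem_nhdsWithin] with a ha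
  rw [slope_def_module, hslope, inv_smul_smul₀ (sub_ne_zero.2 ha)]

end IsParametricField

end Curves

theorem hasFDerivAt_uncurry_of_partials {f fx fy : ℝ → ℝ → ℝ} {z : ℝ × ℝ}
    (hx : ∀ᶠ p in 𝓝 z, HasDerivAt (f · p.2) (fx p.1 p.2) p.1)
    (hy : ∀ x y, HasDerivAt (f x) (fy x y) y) (cx : Continuous (Function.uncurry fx))
    (cy : Continuous (Function.uncurry fy)) :
    HasFDerivAt (Function.uncurry f)
      (fx z.1 z.2 • ContinuousLinearMap.fst ℝ ℝ ℝ + fy z.1 z.2 • ContinuousLinearMap.snd ℝ ℝ ℝ)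
      z := by
  let span := ContinuousLinearMap.toSpanSingletonCLE (𝕜 := ℝ) (E := ℝ)
  have h := (hasStrictFDerivAt_uncurry_coprod (f := f) (f₁ := fun x y => span (fx x y))
    (f₂ := fun x y => span (fy x y)) (hx.mono fun _ hp => hp.hasFDerivAt)
    (Eventually.of_forall fun p => (hy p.1 p.2).hasFDerivAt) (span.continuous.comp cx).continuousAt
    (span.continuous.comp cy).continuousAt).hasFDerivAt
  exact HasFDerivAt.congr_fderiv (f' := (span (fx z.1 z.2)).coprod (span (fy z.1 z.2))) h
    (by ext <;> simp [span])

/-! ### The damped oscillator -/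

section Oscillator

variable {T ν κ : ℝ} {K : ℝ≥0} {g ga gp : ℝ → ℝ → ℝ → ℝ}

/-- The field of the damped oscillators `p' = q`, `q' = -ν q + g t a p` labelled by `a`, with state
`(a, (p, q))`. -/
def oscillatorField (ν : ℝ) (g : ℝ → ℝ → ℝ → ℝ) (t : ℝ) (z : ℝ × ℝ × ℝ) : ℝ × ℝ :=
  (z.2.2, -ν * z.2.2 + g t z.1 z.2.1)

/-- The derivative of `oscillatorField ν g t`, given the partial derivatives `ga` and `gp` of
`g t`. -/
noncomputable def oscillatorFDeriv (ν : ℝ) (ga gp : ℝ → ℝ → ℝ → ℝ) (t : ℝ) (z : ℝ × ℝ × ℝ) :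
    ℝ × ℝ × ℝ →L[ℝ] ℝ × ℝ :=
  let p : ℝ × ℝ × ℝ →L[ℝ] ℝ := (ContinuousLinearMap.fst ℝ ℝ ℝ).comp (.snd ℝ ℝ (ℝ × ℝ))
  let q : ℝ × ℝ × ℝ →L[ℝ] ℝ := (ContinuousLinearMap.snd ℝ ℝ ℝ).comp (.snd ℝ ℝ (ℝ × ℝ))
  q.smulRight (1, -ν) + ga t z.1 z.2.1 • (ContinuousLinearMap.fst ℝ ℝ (ℝ × ℝ)).smulRight (0, 1) +
    gp t z.1 z.2.1 • p.smulRight (0, 1)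

theorem oscillatorFDeriv_apply (t : ℝ) (z w : ℝ × ℝ × ℝ) : oscillatorFDeriv ν ga gp t z w =
    (w.2.2, -ν * w.2.2 + (ga t z.1 z.2.1 * w.1 + gp t z.1 z.2.1 * w.2.1)) := by
  ext
  · simp [oscillatorFDeriv]
  · simp [oscillatorFDeriv]; ring

theorem norm_damped_le {β r : ℝ} (hκ : 0 ≤ κ) (hβ : 0 ≤ β) (hK : 1 + |ν| + κ ≤ K) (w : ℝ × ℝ)
    (hr : |r| ≤ κ * |w.1| + β) : ‖(w.2, -ν * w.2 + r)‖ ≤ K * ‖w‖ + β := by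
  have hw₁ : |w.1| ≤ ‖w‖ := norm_fst_le w
  have hw₂ : |w.2| ≤ ‖w‖ := norm_snd_le w
  have hν := abs_nonneg ν
  rw [Prod.norm_mk, Real.norm_eq_abs, Real.norm_eq_abs]
  refine max_le ?_ ?_
  · nlinarith [norm_nonneg w]
  · calc |-ν * w.2 + r| ≤ |-ν * w.2| + |r| := abs_add_le _ _
      _ = |ν| * |w.2| + |r| := by rw [abs_mul, abs_neg]
      _ ≤ |ν| * ‖w‖ + (κ * ‖w‖ + β) := by gcongr; exact hr.trans (by gcongr)
      _ ≤ K * ‖w‖ + β := by nlinarith [norm_nonneg w]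

theorem isParametricField_oscillatorField
    (cg : Continuous fun q : ℝ × ℝ × ℝ => g q.1 q.2.1 q.2.2)
    (cga : Continuous fun q : ℝ × ℝ × ℝ => ga q.1 q.2.1 q.2.2)
    (cgp : Continuous fun q : ℝ × ℝ × ℝ => gp q.1 q.2.1 q.2.2)
    (hga : ∀ t a p, HasDerivAt (g t · p) (ga t a p) a)
    (hgp : ∀ t a p, HasDerivAt (g t a) (gp t a p) p)
    (hκ : ∀ t a p, |gp t a p| ≤ κ) (hK : 1 + |ν| + κ ≤ K) :
    IsParametricField K (oscillatorField ν g) (oscillatorFDeriv ν ga gp) where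
  continuous := by
    unfold oscillatorField Function.uncurry
    fun_prop
  continuous_fderiv := by
    unfold oscillatorFDeriv Function.uncurry
    fun_prop
  hasFDerivAt t z := by
    have hp : HasFDerivAt (fun z : ℝ × ℝ × ℝ => z.2.1) _ z :=
      ((ContinuousLinearMap.fst ℝ ℝ ℝ).comp (.snd ℝ ℝ (ℝ × ℝ))).hasFDerivAt
    have hq : HasFDerivAt (fun z : ℝ × ℝ × ℝ => z.2.2) _ z :=
      ((ContinuousLinearMap.snd ℝ ℝ ℝ).comp (.snd ℝ ℝ (ℝ × ℝ))).hasFDerivAt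
    have hg := (hasFDerivAt_uncurry_of_partials (f := g t) (Eventually.of_forall fun p =>
      hga t p.1 p.2) (hgp t) (by unfold Function.uncurry; fun_prop)
      (by unfold Function.uncurry; fun_prop)).comp z (hasFDerivAt_fst.prodMk hp)
    refine (hq.prodMk ((hq.const_mul (-ν)).add hg)).congr_fderiv
      (ContinuousLinearMap.ext fun w => ?_)
    rw [oscillatorFDeriv_apply]
    simp
  norm_fderiv_inr_le t z w := by
    have hκ₀ : 0 ≤ κ := (abs_nonneg _).trans (hκ t z.1 z.2.1)
    have hr : |gp t z.1 z.2.1 * w.1| ≤ κ * |w.1| + 0 := by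
      rw [abs_mul, add_zero]
      exact mul_le_mul_of_nonneg_right (hκ _ _ _) (abs_nonneg _)
    simpa [oscillatorFDeriv_apply] using norm_damped_le hκ₀ le_rfl hK w hr

/-- The oscillator is driven by `r`, up to a restoring force of strength `κ`, through `f`. -/
theorem HasVelocityOn.norm_le_of_oscillator {w : ℝ → ℝ × ℝ} {r f : ℝ → ℝ}
    (h : HasVelocityOn T w fun t => ((w t).2, -ν * (w t).2 + r t)) (hT : 0 ≤ T) (hκ : 0 ≤ κ)
    (hK : 1 + |ν| + κ ≤ K) (hKT : K * T ≤ 1 / 2) (hf : Continuous f)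
    (hr : ∀ t, |r t - f t| ≤ κ * |(w t).1|) (t : ℝ) :
    ‖w t‖ ≤ 2 * (‖w 0‖ + ∫ τ in -T..T, ‖f τ‖) :=
  h.norm_le_two_mul hT K.2 hKT hf.norm (fun _ => norm_nonneg _)
    (fun t _ => norm_damped_le hκ (norm_nonneg _) hK (w t)
      ((sub_le_iff_le_add.1 (abs_sub_abs_le_abs_sub _ _)).trans
        (by gcongr; exacts [hr t, le_rfl]))) t

end Oscillator

theorem continuous_of_hasDerivAt {f f' : ℝ → ℝ} (hf : ∀ x, HasDerivAt f (f' x) x) :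
    Continuous f :=
  continuous_iff_continuousAt.2 fun x => (hf x).continuousAt

theorem abs_sub_le_of_abs_deriv_le {f f' : ℝ → ℝ} {C : ℝ} (hf : ∀ x, HasDerivAt f (f' x) x)
    (hC : ∀ x, |f' x| ≤ C) (x y : ℝ) : |f y - f x| ≤ C * |y - x| :=
  convex_univ.norm_image_sub_le_of_norm_hasDerivWithin_le (fun x _ => (hf x).hasDerivWithinAt)
    (fun x _ => hC x) (mem_univ x) (mem_univ y)

/-- Continuous bounded functions of `(t, x)`, in curried form. -/
structure BddContinuous (f : ℝ → ℝ → ℝ) : Prop where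
  continuous : Continuous (Function.uncurry f)
  bounded : ∃ C, ∀ t x, |f t x| ≤ C

namespace BddContinuous

variable {f g : ℝ → ℝ → ℝ}

theorem const (c : ℝ) : BddContinuous fun _ _ => c :=
  ⟨continuous_const, |c|, fun _ _ => le_rfl⟩

theorem mono (hf : Continuous (Function.uncurry f)) (hg : BddContinuous g)
    (h : ∀ t x, |f t x| ≤ |g t x|) : BddContinuous f :=
  let ⟨C, hC⟩ := hg.bounded
  ⟨hf, C, fun t x => (h t x).trans (hC t x)⟩

theorem add (hf : BddContinuous f) (hg : BddContinuous g) :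
    BddContinuous fun t x => f t x + g t x :=
  let ⟨A, hA⟩ := hf.bounded
  let ⟨B, hB⟩ := hg.bounded
  ⟨hf.continuous.add hg.continuous, A + B,
    fun t x => (abs_add_le _ _).trans (add_le_add (hA t x) (hB t x))⟩

theorem mul (hf : BddContinuous f) (hg : BddContinuous g) :
    BddContinuous fun t x => f t x * g t x :=
  let ⟨A, hA⟩ := hf.bounded
  let ⟨B, hB⟩ := hg.bounded
  ⟨hf.continuous.mul hg.continuous, A * B, fun t x => (abs_mul _ _).le.trans
    (mul_le_mul (hA t x) (hB t x) (abs_nonneg _) ((abs_nonneg _).trans (hA t x)))⟩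

theorem const_mul (c : ℝ) (hf : BddContinuous f) : BddContinuous fun t x => c * f t x :=
  (const c).mul hf

theorem sub (hf : BddContinuous f) (hg : BddContinuous g) :
    BddContinuous fun t x => f t x - g t x := by
  simpa only [neg_one_mul, ← sub_eq_add_neg] using hf.add (hg.const_mul (-1))

theorem comp {X : ℝ → ℝ → ℝ} (hf : BddContinuous f) (cX : Continuous (Function.uncurry X)) :
    BddContinuous fun t x => f t (X t x) :=
  let ⟨C, hC⟩ := hf.bounded
  ⟨hf.continuous.comp (continuous_fst.prodMk cX), C, fun t x => hC t (X t x)⟩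

theorem continuous_slice (hf : BddContinuous f) (t : ℝ) : Continuous (f t) :=
  hf.continuous.comp (Continuous.prodMk_right t)

theorem slice (hf : BddContinuous f) (t : ℝ) : BddContinuous fun _ => f t :=
  let ⟨C, hC⟩ := hf.bounded
  ⟨(hf.continuous_slice t).comp continuous_snd, C, fun _ => hC t⟩

theorem exists_integral_abs_le (hf : BddContinuous f) (a b : ℝ) :
    ∃ C, ∀ x, ∫ t in a..b, |f t x| ≤ C := by
  obtain ⟨C, hC⟩ := hf.bounded
  refine ⟨C * |b - a|, fun x => (Real.le_norm_self _).trans ?_⟩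
  exact intervalIntegral.norm_integral_le_of_norm_le_const fun t _ => by simpa using hC t x

end BddContinuous

section LpNorms

variable {α β E : Type*} [MeasurableSpace α] [MeasurableSpace β] [NormedAddCommGroup E]
  {p : ℝ≥0∞}

theorem lintegral_rpow_le_measure_univ_rpow_mul {μ : Measure α} {f : α → ℝ≥0∞} {q : ℝ}
    (hq : 1 ≤ q) (hf : AEMeasurable f μ) :
    (∫⁻ x, f x ∂μ) ^ q ≤ μ univ ^ (q - 1) * ∫⁻ x, f x ^ q ∂μ := by
  have hq0 : 0 < q := by linarith
  have h := eLpNorm'_le_eLpNorm'_mul_rpow_measure_univ one_pos hq hf.aestronglyMeasurable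
  simp only [eLpNorm'_eq_lintegral_enorm, enorm_eq_self, ENNReal.rpow_one, div_one] at h
  calc (∫⁻ x, f x ∂μ) ^ q
    _ ≤ ((∫⁻ x, f x ^ q ∂μ) ^ (1 / q) * μ univ ^ (1 - 1 / q)) ^ q := by gcongr
    _ = μ univ ^ (q - 1) * ∫⁻ x, f x ^ q ∂μ := by
      rw [ENNReal.mul_rpow_of_nonneg _ _ hq0.le, ← ENNReal.rpow_mul, ← ENNReal.rpow_mul,
        one_div_mul_cancel hq0.ne', ENNReal.rpow_one, sub_mul, one_div_mul_cancel hq0.ne', one_mul,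
        mul_comm]

theorem eLpNorm_integral_le_measure_univ_mul [NormedSpace ℝ E] {μ : Measure α} {ν : Measure β}
    [SFinite μ] [SFinite ν] {F : α → β → E} {M : ℝ≥0∞} (hp : 1 ≤ p) (hp' : p ≠ ⊤)
    (hF : StronglyMeasurable (Function.uncurry F)) (hM : ∀ᵐ τ ∂μ, eLpNorm (F τ) p ν ≤ M) :
    eLpNorm (fun x => ∫ τ, F τ x ∂μ) p ν ≤ μ univ * M := by
  have hp0 : p ≠ 0 := (one_pos.trans_le hp).ne'
  have hq : 1 ≤ p.toReal := by simpa using ENNReal.toReal_mono hp' hp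
  have hq0 : 0 < p.toReal := by linarith
  have hpow : ∀ f : β → E, ∫⁻ x, ‖f x‖ₑ ^ p.toReal ∂ν = eLpNorm f p ν ^ p.toReal := fun f => by
    rw [eLpNorm_eq_eLpNorm' hp0 hp', lintegral_rpow_enorm_eq_rpow_eLpNorm' hq0]
  rw [← ENNReal.rpow_le_rpow_iff hq0, ← hpow]
  calc ∫⁻ x, ‖∫ τ, F τ x ∂μ‖ₑ ^ p.toReal ∂ν
    _ ≤ ∫⁻ x, μ univ ^ (p.toReal - 1) * ∫⁻ τ, ‖F τ x‖ₑ ^ p.toReal ∂μ ∂ν := by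
      refine lintegral_mono fun x => ?_
      refine (ENNReal.rpow_le_rpow (enorm_integral_le_lintegral_enorm _) hq0.le).trans ?_
      exact lintegral_rpow_le_measure_univ_rpow_mul hq
        (hF.comp_measurable measurable_prodMk_right).enorm.aemeasurable
    _ = μ univ ^ (p.toReal - 1) * ∫⁻ τ, ∫⁻ x, ‖F τ x‖ₑ ^ p.toReal ∂ν ∂μ := by
      have hmeas : Measurable fun z : β × α => ‖F z.2 z.1‖ₑ ^ p.toReal :=
        (hF.comp_measurable measurable_swap).enorm.pow_const _
      rw [lintegral_const_mul _ hmeas.lintegral_prod_right',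
        lintegral_lintegral_swap hmeas.aemeasurable]
    _ ≤ μ univ ^ (p.toReal - 1) * ∫⁻ _, M ^ p.toReal ∂μ := by
      refine mul_le_mul' le_rfl (lintegral_mono_ae (hM.mono fun τ hτ => ?_))
      rw [hpow]
      gcongr
    _ = (μ univ * M) ^ p.toReal := by
      rw [lintegral_const, ENNReal.mul_rpow_of_nonneg _ _ hq0.le, mul_comm (M ^ _), ← mul_assoc]
      congr 1
      nth_rw 2 [← ENNReal.rpow_one (μ univ)]
      rw [← ENNReal.rpow_add_of_nonneg _ _ (by linarith) zero_le_one, sub_add_cancel]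

theorem eLpNorm_intervalIntegral_le [NormedSpace ℝ E] {T : ℝ} {F : ℝ → ℝ → E} {M : ℝ≥0∞}
    (hp : 1 ≤ p) (hp' : p ≠ ⊤) (hT : 0 ≤ T) (hF : Continuous (Function.uncurry F))
    (hM : ∀ τ, eLpNorm (F τ) p ≤ M) :
    eLpNorm (fun x => ∫ τ in -T..T, F τ x) p ≤ ENNReal.ofReal (2 * T) * M := by
  have h := eLpNorm_integral_le_measure_univ_mul (μ := volume.restrict (Ioc (-T) T)) hp hp'
    hF.stronglyMeasurable (Eventually.of_forall hM)
  simpa [intervalIntegral.integral_of_le (neg_le_self hT), two_mul] using h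

theorem map_volume_le_of_antilipschitzWith {f : ℝ → ℝ} {K : ℝ≥0} (hf : AntilipschitzWith K f)
    (hfm : Measurable f) : (volume : Measure ℝ).map f ≤ K • (volume : Measure ℝ) := by
  refine Measure.le_iff.2 fun s hs => ?_
  rw [Measure.map_apply hfm hs, ← hausdorffMeasure_real]
  have h := hf.hausdorffMeasure_preimage_le zero_le_one s
  rw [ENNReal.rpow_one] at h
  exact h

theorem eLpNorm_comp_le_of_antilipschitzWith {f : ℝ → ℝ} {g : ℝ → E} {K : ℝ≥0} (hp : p ≠ ⊤)
    (hf : AntilipschitzWith K f) (hfm : Measurable f) (hg : AEStronglyMeasurable g) :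
    eLpNorm (fun x => g (f x)) p ≤ (K ^ p.toReal⁻¹ : ℝ≥0) * eLpNorm g p := by
  have hmap := map_volume_le_of_antilipschitzWith hf hfm
  have hg' : AEStronglyMeasurable g ((volume : Measure ℝ).map f) :=
    hg.mono_ac (hmap.absolutelyContinuous.trans (Measure.smul_absolutelyContinuous (c := K)))
  have h := eLpNorm_mono_measure (p := p) g hmap
  rw [eLpNorm_map_measure hg' hfm.aemeasurable, eLpNorm_smul_measure_of_ne_top' hp] at h
  exact h

end LpNorms

/-- Continuous functions of `(t, x)`, in curried form, whose slices `f t` are bounded in `L^p`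
uniformly in `t`. -/
structure BddInLp (p : ℝ≥0∞) (f : ℝ → ℝ → ℝ) : Prop where
  continuous : Continuous (Function.uncurry f)
  bounded : ∃ C : ℝ≥0, ∀ t, eLpNorm (f t) p ≤ C

namespace BddInLp

variable {p : ℝ≥0∞} {f g : ℝ → ℝ → ℝ}

theorem continuous_slice (hf : BddInLp p f) (t : ℝ) : Continuous (f t) :=
  hf.continuous.comp (Continuous.prodMk_right t)

theorem memLp (hf : BddInLp p f) (t : ℝ) : MemLp (f t) p :=
  let ⟨_, hC⟩ := hf.bounded
  ⟨(hf.continuous_slice t).aestronglyMeasurable, (hC t).trans_lt ENNReal.coe_lt_top⟩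

theorem of_memLp {f : ℝ → ℝ} (hf : Continuous f) (hfp : MemLp f p) : BddInLp p fun _ => f := by
  refine ⟨hf.comp continuous_snd, (eLpNorm f p).toNNReal, fun _ => ?_⟩
  rw [ENNReal.coe_toNNReal hfp.2.ne]

theorem mono (hf : Continuous (Function.uncurry f)) (hg : BddInLp p g)
    (h : ∀ t x, |f t x| ≤ g t x) : BddInLp p f :=
  let ⟨C, hC⟩ := hg.bounded
  ⟨hf, C, fun t => (eLpNorm_mono_real (h t)).trans (hC t)⟩

theorem abs (hf : BddInLp p f) : BddInLp p fun t x => |f t x| :=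
  let ⟨C, hC⟩ := hf.bounded
  ⟨hf.continuous.abs, C, fun t => (eLpNorm_norm (f t)).trans_le (hC t)⟩

theorem add (hp : 1 ≤ p) (hf : BddInLp p f) (hg : BddInLp p g) :
    BddInLp p fun t x => f t x + g t x :=
  let ⟨A, hA⟩ := hf.bounded
  let ⟨B, hB⟩ := hg.bounded
  ⟨hf.continuous.add hg.continuous, A + B, fun t => (eLpNorm_add_le (hf.memLp t).1 (hg.memLp t).1
    hp).trans ((add_le_add (hA t) (hB t)).trans_eq (ENNReal.coe_add A B).symm)⟩

theorem bdd_mul (hf : BddContinuous f) (hg : BddInLp p g) : BddInLp p fun t x => f t x * g t x := by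
  obtain ⟨A, hA⟩ := hf.bounded
  obtain ⟨B, hB⟩ := hg.bounded
  refine ⟨hf.continuous.mul hg.continuous, A.toNNReal * B, fun t => ?_⟩
  refine (eLpNorm_le_mul_eLpNorm_of_ae_le_mul (c := A) (Eventually.of_forall fun x => ?_) p).trans
    ((mul_le_mul_right (hB t) _).trans_eq (ENNReal.coe_mul _ _).symm)
  rw [norm_mul]
  exact mul_le_mul_of_nonneg_right (hA t x) (norm_nonneg _)

theorem const_mul (c : ℝ) (hf : BddInLp p f) : BddInLp p fun t x => c * f t x :=
  bdd_mul (.const c) hf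

theorem sub (hp : 1 ≤ p) (hf : BddInLp p f) (hg : BddInLp p g) :
    BddInLp p fun t x => f t x - g t x := by
  simpa only [neg_one_mul, ← sub_eq_add_neg] using hf.add hp (hg.const_mul (-1))

theorem mul {q r : ℝ≥0∞} [ENNReal.HolderTriple p q r] (hf : BddInLp p f) (hg : BddInLp q g) :
    BddInLp r fun t x => f t x * g t x :=
  let ⟨A, hA⟩ := hf.bounded
  let ⟨B, hB⟩ := hg.bounded
  ⟨hf.continuous.mul hg.continuous, A * B, fun t => (eLpNorm_smul_le_mul_eLpNorm (hg.memLp t).1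
    (hf.memLp t).1).trans ((mul_le_mul' (hA t) (hB t)).trans_eq (ENNReal.coe_mul A B).symm)⟩

theorem comp {X : ℝ → ℝ → ℝ} {K : ℝ≥0} (hp : p ≠ ⊤) (hf : BddInLp p f)
    (cX : Continuous (Function.uncurry X)) (hX : ∀ t, AntilipschitzWith K (X t)) :
    BddInLp p fun t x => f t (X t x) := by
  obtain ⟨C, hC⟩ := hf.bounded
  refine ⟨hf.continuous.comp (continuous_fst.prodMk cX), K ^ p.toReal⁻¹ * C, fun t => ?_⟩
  exact (eLpNorm_comp_le_of_antilipschitzWith hp (hX t) (cX.uncurry_left t).measurable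
    (hf.memLp t).1).trans ((mul_le_mul_right (hC t) _).trans_eq (ENNReal.coe_mul _ _).symm)

theorem intervalIntegral {T : ℝ} (hp : 1 ≤ p) (hp' : p ≠ ⊤) (hT : 0 ≤ T) (hf : BddInLp p f) :
    BddInLp p fun _ x => ∫ τ in -T..T, f τ x := by
  obtain ⟨C, hC⟩ := hf.bounded
  have hcont : Continuous fun x => ∫ τ in -T..T, f τ x :=
    intervalIntegral.continuous_parametric_intervalIntegral_of_continuous'
      (f := fun x τ => f τ x) (hf.continuous.comp continuous_swap) _ _
  exact ⟨hcont.comp continuous_snd, (2 * T).toNNReal * C, fun _ =>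
    (eLpNorm_intervalIntegral_le hp hp' hT hf.continuous hC).trans_eq (ENNReal.coe_mul _ _).symm⟩

end BddInLp

/-! ### The particle flow -/

/-- The data of the Lagrangian problem, with the bounds its solution uses: the background density
`c` with `∂ₓΓ = c` and `∂ₓc = cx`, the initial density `ρ₀ = m'` with `ρ₀' = ρ₁`, and the initial
velocity `u₀` with `u₀' = u₁`, `u₀'' = u₂`. Then `Γ t x - m x` is a primitive of `c t - ρ₀`, and the
field `∂ₓφ` at the particle labelled `a` is `Γ t (X t a) - m a`. -/
structure LagrangianData where
  (Γ c cx : ℝ → ℝ → ℝ)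
  (m ρ₀ ρ₁ u₀ u₁ u₂ : ℝ → ℝ)
  (κ : ℝ≥0)
  hasDerivAt_Γ : ∀ t x, HasDerivAt (Γ t) (c t x) x
  hasDerivAt_c : ∀ t x, HasDerivAt (c t) (cx t x) x
  hasDerivAt_m : ∀ x, HasDerivAt m (ρ₀ x) x
  hasDerivAt_ρ₀ : ∀ x, HasDerivAt ρ₀ (ρ₁ x) x
  hasDerivAt_u₀ : ∀ x, HasDerivAt u₀ (u₁ x) x
  hasDerivAt_u₁ : ∀ x, HasDerivAt u₁ (u₂ x) x
  continuous_c : Continuous (Function.uncurry c)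
  abs_c_le : ∀ t x, |c t x| ≤ κ
  abs_ρ₀_le : ∀ x, |ρ₀ x| ≤ κ
  abs_u₁_le : ∀ x, |u₁ x| ≤ κ
  bdd_cx : BddContinuous cx
  bdd_ρ₁ : BddContinuous fun _ => ρ₁
  bdd_u₀ : BddContinuous fun _ => u₀
  bdd_u₂ : BddContinuous fun _ => u₂
  bdd_field : BddContinuous fun t x => Γ t x - m x
  bddInLp_field : BddInLp 2 fun t x => Γ t x - m x
  bddInLp_c_sub : BddInLp 1 fun t x => c t x - ρ₀ x
  bddInLp_cx : BddInLp 2 fun _ => cx 0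
  bddInLp_u₀ : BddInLp 2 fun _ => u₀
  bddInLp_u₁ : BddInLp 1 fun _ => u₁

namespace LagrangianData

variable (d : LagrangianData) {k ν T : ℝ}

theorem continuous_m : Continuous d.m := continuous_of_hasDerivAt d.hasDerivAt_m

theorem continuous_ρ₀ : Continuous d.ρ₀ := continuous_of_hasDerivAt d.hasDerivAt_ρ₀

theorem continuous_u₁ : Continuous d.u₁ := continuous_of_hasDerivAt d.hasDerivAt_u₁

theorem continuous_Γ : Continuous (Function.uncurry d.Γ) := by
  convert d.bdd_field.continuous.add (d.continuous_m.comp continuous_snd) using 1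
  ext z
  exact (sub_add_cancel _ _).symm

theorem continuous_cx : Continuous (Function.uncurry d.cx) := d.bdd_cx.continuous

theorem continuous_ρ₁ : Continuous d.ρ₁ := d.bdd_ρ₁.continuous_slice 0

theorem continuous_u₂ : Continuous d.u₂ := d.bdd_u₂.continuous_slice 0

theorem bdd_c : BddContinuous d.c := ⟨d.continuous_c, _, d.abs_c_le⟩

theorem bdd_ρ₀ : BddContinuous fun _ => d.ρ₀ :=
  ⟨d.continuous_ρ₀.comp continuous_snd, _, fun _ => d.abs_ρ₀_le⟩

/-- A growth rate of the Lagrangian system: it dominates the Lipschitz constant `1 + |ν| + |k| κ`,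
with room for keeping `∂ₐX` close to `1` as long as `rate * T ≤ 1 / 2`. -/
noncomputable def rate (k ν : ℝ) : ℝ≥0 := 5 + ‖ν‖₊ + (‖k‖₊ + 2) * d.κ

theorem coe_rate (k ν : ℝ) : (d.rate k ν : ℝ) = 5 + |ν| + (|k| + 2) * d.κ := by
  simp [rate]

theorem one_add_le_rate (k ν : ℝ) : 1 + |ν| + |k| * d.κ ≤ d.rate k ν := by
  rw [coe_rate]
  nlinarith [d.κ.coe_nonneg]

end LagrangianData

/-- The particle flow `X` and the particle velocities `U` on `[-T, T]`, with the derivatives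
`Y = ∂ₐX`, `V = ∂ₐU`, `Z = ∂ₐY`, `W = ∂ₐV` with respect to the label `a`. -/
structure ParticleFlow (d : LagrangianData) (k ν T : ℝ) where
  (X U Y V Z W : ℝ → ℝ → ℝ)
  T_pos : 0 < T
  rate_mul_le : d.rate k ν * T ≤ 1 / 2
  X_zero : ∀ a, X 0 a = a
  U_zero : ∀ a, U 0 a = d.u₀ a
  Y_zero : ∀ a, Y 0 a = 1
  V_zero : ∀ a, V 0 a = d.u₁ a
  Z_zero : ∀ a, Z 0 a = 0
  W_zero : ∀ a, W 0 a = d.u₂ a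
  hasVelocityOn : ∀ a, HasVelocityOn T (fun t => (X t a, U t a)) fun t =>
    (U t a, -ν * U t a + -k * (d.Γ t (X t a) - d.m a))
  hasVelocityOn_deriv : ∀ a, HasVelocityOn T (fun t => (Y t a, V t a)) fun t =>
    (V t a, -ν * V t a + -k * (d.c t (X t a) * Y t a - d.ρ₀ a))
  hasVelocityOn_deriv₂ : ∀ a, HasVelocityOn T (fun t => (Z t a, W t a)) fun t =>
    (W t a, -ν * W t a +
      -k * (d.cx t (X t a) * Y t a * Y t a - d.ρ₁ a + d.c t (X t a) * Z t a))
  hasDerivAt_X : ∀ t a, HasDerivAt (X t) (Y t a) a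
  hasDerivAt_U : ∀ t a, HasDerivAt (U t) (V t a) a
  hasDerivAt_Y : ∀ t a, HasDerivAt (Y t) (Z t a) a
  continuous_X : Continuous (Function.uncurry X)
  continuous_U : Continuous (Function.uncurry U)
  continuous_Y : Continuous (Function.uncurry Y)
  continuous_V : Continuous (Function.uncurry V)
  continuous_Z : Continuous (Function.uncurry Z)

namespace LagrangianData

variable (d : LagrangianData) {k ν T : ℝ}

theorem abs_neg_mul_c_le (k : ℝ) (t x : ℝ) : |-k * d.c t x| ≤ |k| * d.κ := by
  rw [abs_mul, abs_neg]
  exact mul_le_mul_of_nonneg_left (d.abs_c_le t x) (abs_nonneg k)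

theorem isParametricField_flow (k ν : ℝ) : IsParametricField (d.rate k ν)
    (oscillatorField ν fun t a p => -k * (d.Γ t p - d.m a))
    (oscillatorFDeriv ν (fun _ a _ => -k * (-d.ρ₀ a)) fun t _ p => -k * d.c t p) := by
  have cΓ := d.continuous_Γ
  have cm := d.continuous_m
  have cρ := d.continuous_ρ₀
  have cc := d.continuous_c
  exact isParametricField_oscillatorField (by fun_prop) (by fun_prop) (by fun_prop)
    (fun t a p => ((d.hasDerivAt_m a).const_sub _).const_mul _)
    (fun t a p => ((d.hasDerivAt_Γ t p).sub_const _).const_mul _)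
    (fun t _ p => d.abs_neg_mul_c_le k t p) (d.one_add_le_rate k ν)

theorem isParametricField_flow_deriv (k ν : ℝ) {X Y : ℝ → ℝ → ℝ}
    (cX : Continuous (Function.uncurry X)) (cY : Continuous (Function.uncurry Y))
    (hX : ∀ t a, HasDerivAt (X t) (Y t a) a) : IsParametricField (d.rate k ν)
    (oscillatorField ν fun t a p => -k * (d.c t (X t a) * p - d.ρ₀ a))
    (oscillatorFDeriv ν (fun t a p => -k * (d.cx t (X t a) * Y t a * p - d.ρ₁ a))
      fun t a _ => -k * d.c t (X t a)) := by
  have cρ := d.continuous_ρ₀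
  have cρ₁ := d.continuous_ρ₁
  have cc := d.continuous_c
  have ccx := d.continuous_cx
  exact isParametricField_oscillatorField (by fun_prop) (by fun_prop) (by fun_prop)
    (fun t a p => ((((d.hasDerivAt_c t _).comp a (hX t a)).mul_const p).sub
      (d.hasDerivAt_ρ₀ a)).const_mul _)
    (fun t a p => by
      simpa using (((hasDerivAt_id p).const_mul (d.c t (X t a))).sub_const (d.ρ₀ a)).const_mul (-k))
    (fun t a _ => d.abs_neg_mul_c_le k t _) (d.one_add_le_rate k ν)

theorem exists_flow (hT : 0 ≤ T) (hKT : d.rate k ν * T ≤ 1 / 2) : ∃ y D : ℝ → ℝ → ℝ × ℝ,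
    Continuous (Function.uncurry y) ∧ Continuous (Function.uncurry D) ∧
    y 0 = (fun a => (a, d.u₀ a)) ∧ D 0 = (fun a => (1, d.u₁ a)) ∧
    (∀ t a, HasDerivAt (y t) (D t a) a) ∧
    (∀ a, HasVelocityOn T (y · a) fun t =>
      oscillatorField ν (fun t a p => -k * (d.Γ t p - d.m a)) t (a, y t a)) ∧
    ∀ a, HasVelocityOn T (D · a) fun t =>
      oscillatorField ν (fun t a p => -k * (d.c t (y t a).1 * p - d.ρ₀ a)) t (a, D t a) := by
  have hflow := d.isParametricField_flow k ν
  have cu₁ := d.continuous_u₁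
  obtain ⟨y, hy₀, cy, hy⟩ := hflow.exists_hasVelocityOn hT hKT
    (y₀ := fun a => (a, d.u₀ a)) (continuous_id.prodMk (continuous_of_hasDerivAt d.hasDerivAt_u₀))
  obtain ⟨D, hD₀, cD, hD, hDv⟩ := hflow.exists_hasDerivAt hT hKT cy
    (y₀' := fun a => (1, d.u₁ a))
    (fun a => hy₀ ▸ (hasDerivAt_id a).prodMk (d.hasDerivAt_u₀ a)) (by fun_prop) hy
  refine ⟨y, D, cy, cD, hy₀, hD₀, hD, hy, fun a => ?_⟩
  convert hDv a using 2 with t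
  rw [oscillatorFDeriv_apply, oscillatorField]
  ring_nf

theorem nonempty_particleFlow (hT : 0 < T) (hKT : d.rate k ν * T ≤ 1 / 2) :
    Nonempty (ParticleFlow d k ν T) := by
  have cu₂ := d.continuous_u₂
  obtain ⟨y, D, cy, cD, hy₀, hD₀, hD, hy, hDv⟩ := d.exists_flow hT.le hKT
  have hX : ∀ t a, HasDerivAt (fun a => (y t a).1) (D t a).1 a := fun t a => (hD t a).fst
  obtain ⟨E, hE₀, cE, hE, hEv⟩ := (d.isParametricField_flow_deriv k ν
    (X := fun t a => (y t a).1) (Y := fun t a => (D t a).1) (by fun_prop) (by fun_prop) hX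
    ).exists_hasDerivAt hT.le hKT cD
    (y₀' := fun a => (0, d.u₂ a))
    (fun a => hD₀ ▸ (hasDerivAt_const a 1).prodMk (d.hasDerivAt_u₁ a)) (by fun_prop) hDv
  exact ⟨{
    X := fun t a => (y t a).1, U := fun t a => (y t a).2
    Y := fun t a => (D t a).1, V := fun t a => (D t a).2
    Z := fun t a => (E t a).1, W := fun t a => (E t a).2
    T_pos := hT
    rate_mul_le := hKT
    X_zero := fun a => by rw [hy₀]
    U_zero := fun a => by rw [hy₀]
    Y_zero := fun a => by rw [hD₀]
    V_zero := fun a => by rw [hD₀]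
    Z_zero := fun a => by rw [hE₀]
    W_zero := fun a => by rw [hE₀]
    hasVelocityOn := hy
    hasVelocityOn_deriv := hDv
    hasVelocityOn_deriv₂ := fun a => by
      convert hEv a using 2 with t
      rw [oscillatorFDeriv_apply]
      ring_nf
    hasDerivAt_X := hX
    hasDerivAt_U := fun t a => (hD t a).snd
    hasDerivAt_Y := fun t a => (hE t a).fst
    continuous_X := by fun_prop
    continuous_U := by fun_prop
    continuous_Y := by fun_prop
    continuous_V := by fun_prop
    continuous_Z := by fun_prop }⟩

end LagrangianData

theorem antilipschitzWith_of_one_le_mul_deriv {f f' : ℝ → ℝ} {K : ℝ≥0}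
    (hf : ∀ x, HasDerivAt f (f' x) x) (hf' : ∀ x, 1 ≤ K * f' x) : AntilipschitzWith K f := by
  have hderiv : ∀ x, HasDerivAt (fun x => K * f x - x) (K * f' x - 1) x := fun x =>
    ((hf x).const_mul (K : ℝ)).sub (hasDerivAt_id x)
  have hmono : Monotone fun x => K * f x - x := monotone_of_hasDerivAt_nonneg hderiv
    fun x => sub_nonneg.2 (hf' x)
  refine AntilipschitzWith.of_le_mul_dist fun x y => ?_
  rw [Real.dist_eq, Real.dist_eq, ← abs_of_nonneg K.coe_nonneg, ← abs_mul, mul_sub]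
  rcases le_total x y with hxy | hxy
  · rw [abs_sub_comm, abs_sub_comm (_ * _), abs_of_nonneg (sub_nonneg.2 hxy)]
    exact (by linarith [hmono hxy] : _ ≤ K * f y - K * f x).trans (le_abs_self _)
  · rw [abs_of_nonneg (sub_nonneg.2 hxy)]
    exact (by linarith [hmono hxy] : _ ≤ K * f x - K * f y).trans (le_abs_self _)

namespace ParticleFlow

variable {d : LagrangianData} {k ν T : ℝ} (p : ParticleFlow d k ν T)

include p

theorem abs_k_mul_κ_mul_T_le : |k| * d.κ * T + (5 + 2 * d.κ) * T ≤ 1 / 2 := by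
  have h := p.rate_mul_le
  rw [d.coe_rate] at h
  nlinarith [mul_nonneg (abs_nonneg ν) p.T_pos.le]

theorem norm_displacement_le (t a : ℝ) : ‖(p.X t a - a, p.U t a)‖ ≤
    2 * (‖d.u₀ a‖ + ∫ τ in -T..T, ‖-k * (d.Γ τ (p.X τ a) - d.m (p.X τ a))‖) := by
  have cX := p.continuous_X
  have cΓ := d.continuous_Γ
  have cm := d.continuous_m
  have hw : HasVelocityOn T (fun t => (p.X t a - a, p.U t a)) fun t =>
      (p.U t a, -ν * p.U t a + -k * (d.Γ t (p.X t a) - d.m a)) := by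
    simpa using (p.hasVelocityOn a).sub (.const (a, (0 : ℝ)))
  refine (hw.norm_le_of_oscillator p.T_pos.le (by positivity) (d.one_add_le_rate k ν)
    p.rate_mul_le (f := fun τ => -k * (d.Γ τ (p.X τ a) - d.m (p.X τ a))) (by fun_prop)
    (fun τ => ?_) t).trans_eq (by simp [p.X_zero, p.U_zero])
  rw [← mul_sub, sub_sub_sub_cancel_left, abs_mul, abs_neg, mul_assoc]
  gcongr
  exact abs_sub_le_of_abs_deriv_le d.hasDerivAt_m d.abs_ρ₀_le a (p.X τ a)

theorem norm_deformation_le (t a : ℝ) : ‖(p.Y t a - 1, p.V t a)‖ ≤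
    2 * (‖d.u₁ a‖ + ∫ τ in -T..T, ‖-k * (d.c τ (p.X τ a) - d.ρ₀ a)‖) := by
  have cX := p.continuous_X
  have cc := d.continuous_c
  have hw : HasVelocityOn T (fun t => (p.Y t a - 1, p.V t a)) fun t =>
      (p.V t a, -ν * p.V t a + -k * (d.c t (p.X t a) * p.Y t a - d.ρ₀ a)) := by
    simpa using (p.hasVelocityOn_deriv a).sub (.const ((1 : ℝ), (0 : ℝ)))
  refine (hw.norm_le_of_oscillator p.T_pos.le (by positivity) (d.one_add_le_rate k ν)
    p.rate_mul_le (f := fun τ => -k * (d.c τ (p.X τ a) - d.ρ₀ a)) (by fun_prop)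
    (fun τ => ?_) t).trans_eq (by simp [p.Y_zero, p.V_zero])
  rw [← mul_sub, sub_sub_sub_cancel_right, ← mul_sub_one, ← mul_assoc, abs_mul]
  gcongr
  exact d.abs_neg_mul_c_le k τ _

theorem norm_deformation_deriv_le (t a : ℝ) : ‖(p.Z t a, p.W t a)‖ ≤ 2 * (‖d.u₂ a‖ +
    ∫ τ in -T..T, ‖-k * (d.cx τ (p.X τ a) * p.Y τ a * p.Y τ a - d.ρ₁ a)‖) := by
  have cX := p.continuous_X
  have cY := p.continuous_Y
  have cc := d.continuous_cx
  refine ((p.hasVelocityOn_deriv₂ a).norm_le_of_oscillator p.T_pos.le (by positivity)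
    (d.one_add_le_rate k ν) p.rate_mul_le
    (f := fun τ => -k * (d.cx τ (p.X τ a) * p.Y τ a * p.Y τ a - d.ρ₁ a)) (by fun_prop)
    (fun τ => ?_) t).trans_eq (by simp [p.Z_zero, p.W_zero])
  rw [← mul_sub, add_sub_cancel_left, ← mul_assoc, abs_mul]
  gcongr
  exact d.abs_neg_mul_c_le k τ _

theorem norm_deformation_le_const (t a : ℝ) : ‖(p.Y t a - 1, p.V t a)‖ ≤ 2 * d.κ + 4 := by
  have hforce : ∀ τ, ‖-k * (d.c τ (p.X τ a) - d.ρ₀ a)‖ ≤ |k| * (2 * d.κ) := fun τ => by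
    rw [norm_mul, norm_neg, Real.norm_eq_abs, two_mul]
    gcongr
    exact (abs_sub _ _).trans (add_le_add (d.abs_c_le _ _) (d.abs_ρ₀_le _))
  have hint := intervalIntegral.norm_integral_le_of_norm_le_const (a := -T) (b := T)
    fun τ _ => (norm_norm _).trans_le (hforce τ)
  rw [Real.norm_eq_abs, sub_neg_eq_add, abs_of_pos (add_pos p.T_pos p.T_pos)] at hint
  have hu₁ : ‖d.u₁ a‖ ≤ d.κ := d.abs_u₁_le a
  have hrate := p.abs_k_mul_κ_mul_T_le
  have hT : 0 ≤ (5 + 2 * (d.κ : ℝ)) * T := mul_nonneg (by positivity) p.T_pos.le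
  have h := p.norm_deformation_le t a
  nlinarith [le_abs_self (∫ τ in -T..T, ‖-k * (d.c τ (p.X τ a) - d.ρ₀ a)‖)]

theorem abs_V_le (t a : ℝ) : |p.V t a| ≤ 2 * d.κ + 4 :=
  (norm_snd_le (p.Y t a - 1, p.V t a)).trans (p.norm_deformation_le_const t a)

theorem abs_Y_sub_one_le (t a : ℝ) : |p.Y t a - 1| ≤ 1 / 2 := by
  have hY := (p.hasVelocityOn_deriv a).clm_comp (.fst ℝ ℝ ℝ)
  have h := hY.norm_sub_le p.T_pos.le (C := 2 * d.κ + 4) (by positivity) continuous_zero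
    (fun _ => le_rfl) (fun τ _ => by simpa using p.abs_V_le τ a) t
  have hrate := p.abs_k_mul_κ_mul_T_le
  have hk : 0 ≤ |k| * d.κ * T := mul_nonneg (by positivity) p.T_pos.le
  simp only [ContinuousLinearMap.coe_fst', p.Y_zero, Pi.zero_apply, intervalIntegral.integral_zero,
    add_zero, Real.norm_eq_abs] at h
  nlinarith [p.T_pos]

theorem half_le_Y (t a : ℝ) : 1 / 2 ≤ p.Y t a := by
  linarith [(abs_le.1 (p.abs_Y_sub_one_le t a)).1]

theorem Y_pos (t a : ℝ) : 0 < p.Y t a := by linarith [p.half_le_Y t a]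

theorem antilipschitzWith_X (t : ℝ) : AntilipschitzWith 2 (p.X t) :=
  antilipschitzWith_of_one_le_mul_deriv (p.hasDerivAt_X t) fun a => by
    push_cast
    linarith [p.half_le_Y t a]

theorem bdd_Y : BddContinuous p.Y :=
  ⟨p.continuous_Y, 3 / 2, fun t a => abs_le.2 ⟨by linarith [p.Y_pos t a],
    by linarith [(abs_le.1 (p.abs_Y_sub_one_le t a)).2]⟩⟩

theorem bdd_inv_Y : BddContinuous fun t a => (p.Y t a)⁻¹ :=
  ⟨p.continuous_Y.inv₀ fun z => (p.Y_pos z.1 z.2).ne', 2, fun t a => by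
    rw [abs_inv, abs_of_pos (p.Y_pos t a)]
    exact inv_le_of_inv_le₀ two_pos ((one_div (2 : ℝ)).symm.trans_le (p.half_le_Y t a))⟩

theorem bdd_V : BddContinuous p.V := ⟨p.continuous_V, _, p.abs_V_le⟩

theorem exists_norm_displacement_le : ∃ C, ∀ t a, ‖(p.X t a - a, p.U t a)‖ ≤ C := by
  obtain ⟨A, hA⟩ := d.bdd_u₀.bounded
  obtain ⟨B, hB⟩ := ((d.bdd_field.comp p.continuous_X).const_mul (-k)).exists_integral_abs_le (-T) T
  exact ⟨2 * (A + B), fun t a => (p.norm_displacement_le t a).trans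
    (mul_le_mul_of_nonneg_left (add_le_add (hA 0 a) (hB a)) zero_le_two)⟩

theorem bdd_X_sub_id : BddContinuous fun t a => p.X t a - a :=
  let ⟨C, hC⟩ := p.exists_norm_displacement_le
  ⟨p.continuous_X.sub continuous_snd, C, fun t a => (norm_fst_le _).trans (hC t a)⟩

theorem bdd_U : BddContinuous p.U :=
  let ⟨C, hC⟩ := p.exists_norm_displacement_le
  ⟨p.continuous_U, C, fun t a => (norm_snd_le (_, p.U t a)).trans (hC t a)⟩

theorem bdd_Z : BddContinuous p.Z := by
  obtain ⟨A, hA⟩ := d.bdd_u₂.bounded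
  obtain ⟨B, hB⟩ := (((((d.bdd_cx.comp p.continuous_X).mul p.bdd_Y).mul p.bdd_Y).sub
    d.bdd_ρ₁).const_mul (-k)).exists_integral_abs_le (-T) T
  exact ⟨p.continuous_Z, 2 * (A + B), fun t a => (norm_fst_le (p.Z t a, p.W t a)).trans
    ((p.norm_deformation_deriv_le t a).trans
      (mul_le_mul_of_nonneg_left (add_le_add (hA 0 a) (hB a)) zero_le_two))⟩

theorem bddInLp_displacement_bound : BddInLp 2 fun _ a =>
    2 * (|d.u₀ a| + ∫ τ in -T..T, |-k * (d.Γ τ (p.X τ a) - d.m (p.X τ a))|) :=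
  (d.bddInLp_u₀.abs.add one_le_two (((d.bddInLp_field.comp ENNReal.ofNat_ne_top p.continuous_X
    p.antilipschitzWith_X).const_mul (-k)).abs.intervalIntegral one_le_two ENNReal.ofNat_ne_top
      p.T_pos.le)).const_mul 2

theorem bddInLp_X_sub_id : BddInLp 2 fun t a => p.X t a - a :=
  p.bddInLp_displacement_bound.mono (p.continuous_X.sub continuous_snd) fun t a =>
    (norm_fst_le (p.X t a - a, p.U t a)).trans (p.norm_displacement_le t a)

theorem bddInLp_U : BddInLp 2 p.U :=
  p.bddInLp_displacement_bound.mono p.continuous_U fun t a =>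
    (norm_snd_le (p.X t a - a, p.U t a)).trans (p.norm_displacement_le t a)

theorem abs_c_zero_X_sub_le (t a : ℝ) :
    |d.c 0 (p.X t a) - d.c 0 a| ≤ ∫ τ in -T..T, |d.cx 0 (p.X τ a) * p.U τ a| := by
  have cX := p.continuous_X
  have cU := p.continuous_U
  have ccx := d.continuous_cx
  have h := (((p.hasVelocityOn a).clm_comp (.fst ℝ ℝ ℝ)).comp_left p.T_pos.le (d.hasDerivAt_c 0)
    (by fun_prop)).norm_sub_le p.T_pos.le le_rfl
      (b := fun τ => |d.cx 0 (p.X τ a) * p.U τ a|) (by fun_prop) (fun _ => abs_nonneg _)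
      (fun τ _ => (zero_add _).ge) t
  simpa [p.X_zero] using h

theorem bddInLp_c_zero_X_sub : BddInLp 1 fun t a => d.c 0 (p.X t a) - d.c 0 a := by
  have cX := p.continuous_X
  have cc := d.continuous_c
  have hcxU : BddInLp 1 fun τ a => d.cx 0 (p.X τ a) * p.U τ a :=
    (d.bddInLp_cx.comp ENNReal.ofNat_ne_top p.continuous_X p.antilipschitzWith_X).mul p.bddInLp_U
  exact (hcxU.abs.intervalIntegral le_rfl ENNReal.one_ne_top p.T_pos.le).mono (by fun_prop)
    p.abs_c_zero_X_sub_le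

/-- Both `∂ₓc` and the particle velocity are square integrable, so that transporting `c 0` along the
flow only adds an integrable function. -/
theorem bddInLp_c_X_sub : BddInLp 1 fun t a => d.c t (p.X t a) - d.ρ₀ a := by
  have hzero : BddInLp 1 fun _ a => d.c 0 a - d.ρ₀ a :=
    .of_memLp (d.bddInLp_c_sub.continuous_slice 0) (d.bddInLp_c_sub.memLp 0)
  have hX : ∀ {f}, BddInLp 1 f → BddInLp 1 fun t a => f t (p.X t a) := fun hf =>
    hf.comp ENNReal.one_ne_top p.continuous_X p.antilipschitzWith_X
  convert ((hX d.bddInLp_c_sub).sub le_rfl (hX hzero)).add le_rfl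
    (p.bddInLp_c_zero_X_sub.add le_rfl hzero) using 3
  ring

theorem bddInLp_deformation_bound : BddInLp 1 fun _ a =>
    2 * (|d.u₁ a| + ∫ τ in -T..T, |-k * (d.c τ (p.X τ a) - d.ρ₀ a)|) :=
  (d.bddInLp_u₁.abs.add le_rfl ((p.bddInLp_c_X_sub.const_mul (-k)).abs.intervalIntegral le_rfl
    ENNReal.one_ne_top p.T_pos.le)).const_mul 2

theorem bddInLp_Y_sub_one : BddInLp 1 fun t a => p.Y t a - 1 :=
  p.bddInLp_deformation_bound.mono (p.continuous_Y.sub continuous_const) fun t a =>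
    (norm_fst_le (p.Y t a - 1, p.V t a)).trans (p.norm_deformation_le t a)

theorem bddInLp_V : BddInLp 1 p.V :=
  p.bddInLp_deformation_bound.mono p.continuous_V fun t a =>
    (norm_snd_le (p.Y t a - 1, p.V t a)).trans (p.norm_deformation_le t a)

end ParticleFlow

theorem surjective_of_abs_sub_le {f : ℝ → ℝ} {C : ℝ} (hf : Continuous f)
    (hC : ∀ x, |f x - x| ≤ C) : Function.Surjective f := by
  have hC' := fun x => abs_le.1 (hC x)
  refine hf.surjective (tendsto_atTop_mono (fun x => ?_)
    (tendsto_atTop_add_const_right atTop (-C) tendsto_id)) (tendsto_atBot_mono (fun x => ?_)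
    (tendsto_atBot_add_const_right atBot C tendsto_id))
  · linarith [(hC' x).1, id_eq x]
  · linarith [(hC' x).2, id_eq x]

/-! ### The inverse flow and the Eulerian solution -/

/-- A bounded continuous function of `(t, x)` with bounded continuous first derivatives; the
derivative `ft` in time is only required on `(-T, T)`. -/
structure HasBddDerivs (T : ℝ) (f ft fx : ℝ → ℝ → ℝ) : Prop where
  hasDerivAt_time : ∀ t ∈ Ioo (-T) T, ∀ x, HasDerivAt (f · x) (ft t x) t
  hasDerivAt_space : ∀ t x, HasDerivAt (f t) (fx t x) x
  bdd : BddContinuous f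
  bdd_time : BddContinuous ft
  bdd_space : BddContinuous fx

theorem hasFDerivAt_uncurry_of_mem_Ioo {T t : ℝ} {f ft fx : ℝ → ℝ → ℝ}
    (hft : ∀ t ∈ Ioo (-T) T, ∀ x, HasDerivAt (f · x) (ft t x) t)
    (hfx : ∀ t x, HasDerivAt (f t) (fx t x) x) (cft : Continuous (Function.uncurry ft))
    (cfx : Continuous (Function.uncurry fx)) (ht : t ∈ Ioo (-T) T) (x : ℝ) :
    HasFDerivAt (Function.uncurry f)
      (ft t x • ContinuousLinearMap.fst ℝ ℝ ℝ + fx t x • ContinuousLinearMap.snd ℝ ℝ ℝ) (t, x) :=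
  hasFDerivAt_uncurry_of_partials (z := (t, x))
    ((continuous_fst.continuousAt.eventually (isOpen_Ioo.mem_nhds ht)).mono
      fun q hq => hft q.1 hq q.2) hfx cft cfx

/-- The linear equivalence `(s, b) ↦ (s, u s + y b)`, the shape of the derivative of
`(t, a) ↦ (t, X t a)`. -/
noncomputable def shearEquiv (u y : ℝ) (hy : y ≠ 0) : (ℝ × ℝ) ≃L[ℝ] ℝ × ℝ :=
  ContinuousLinearEquiv.equivOfInverse
    ((ContinuousLinearMap.fst ℝ ℝ ℝ).prod (u • .fst ℝ ℝ ℝ + y • .snd ℝ ℝ ℝ))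
    ((ContinuousLinearMap.fst ℝ ℝ ℝ).prod (y⁻¹ • (.snd ℝ ℝ ℝ - u • .fst ℝ ℝ ℝ)))
    (fun z => by ext <;> simp [hy]) (fun z => by ext <;> simp [hy])

namespace ParticleFlow

variable {d : LagrangianData} {k ν T : ℝ} (p : ParticleFlow d k ν T)

theorem surjective_X (t : ℝ) : Function.Surjective (p.X t) :=
  let ⟨_, hC⟩ := p.bdd_X_sub_id.bounded
  surjective_of_abs_sub_le (continuous_of_hasDerivAt (p.hasDerivAt_X t)) (hC t)

/-- The inverse flow: the label of the particle sitting at `x` at time `t`. -/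
noncomputable def label (t : ℝ) : ℝ → ℝ := Function.surjInv (p.surjective_X t)

theorem X_label (t x : ℝ) : p.X t (p.label t x) = x := Function.surjInv_eq _ x

theorem label_zero (x : ℝ) : p.label 0 x = x := by
  rw [← p.X_zero (p.label 0 x), p.X_label]

theorem abs_label_sub_le (t x a : ℝ) : |p.label t x - a| ≤ 2 * |x - p.X t a| := by
  simpa [p.X_label, Real.dist_eq] using (p.antilipschitzWith_X t).le_mul_dist (p.label t x) a

theorem continuous_label : Continuous (Function.uncurry p.label) := by
  have cX := p.continuous_X
  refine continuous_iff_continuousAt.2 fun ⟨t, x⟩ => tendsto_iff_dist_tendsto_zero.2 ?_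
  have hlim : Tendsto (fun q : ℝ × ℝ => 2 * |q.2 - p.X q.1 (p.label t x)|) (𝓝 (t, x)) (𝓝 0) := by
    have hcont : Continuous fun q : ℝ × ℝ => 2 * |q.2 - p.X q.1 (p.label t x)| := by fun_prop
    simpa [p.X_label] using hcont.tendsto (t, x)
  exact squeeze_zero (fun _ => dist_nonneg) (fun q => p.abs_label_sub_le q.1 q.2 _) hlim

theorem antilipschitzWith_label (t : ℝ) : AntilipschitzWith 2 (p.label t) := by
  have hY : ∀ a, |p.Y t a| ≤ 2 := fun a => by
    have := abs_le.1 (p.abs_Y_sub_one_le t a)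
    exact abs_le.2 ⟨by linarith, by linarith⟩
  exact (LipschitzWith.of_dist_le_mul fun a b =>
    abs_sub_le_of_abs_deriv_le (p.hasDerivAt_X t) hY b a).to_rightInverse (p.X_label t)

theorem hasDerivAt_X_time {t : ℝ} (ht : t ∈ Ioo (-T) T) (a : ℝ) :
    HasDerivAt (p.X · a) (p.U t a) t := ((p.hasVelocityOn a).hasDerivAt ht).fst

theorem hasDerivAt_label_space (t x : ℝ) : HasDerivAt (p.label t) (p.Y t (p.label t x))⁻¹ x :=
  .of_local_left_inverse (p.continuous_label.uncurry_left t).continuousAt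
    (p.hasDerivAt_X t _) (p.Y_pos t _).ne' (Eventually.of_forall (p.X_label t))

theorem hasDerivAt_label_time {t : ℝ} (ht : t ∈ Ioo (-T) T) (x : ℝ) :
    HasDerivAt (p.label · x) (-(p.U t (p.label t x) * (p.Y t (p.label t x))⁻¹)) t := by
  set a := p.label t x
  have hX := hasFDerivAt_uncurry_of_mem_Ioo (fun _ hτ => p.hasDerivAt_X_time hτ) p.hasDerivAt_X
    p.continuous_U p.continuous_Y ht a
  have hXgraph : HasFDerivAt (fun q : ℝ × ℝ => (q.1, p.X q.1 q.2))
      (shearEquiv (p.U t a) (p.Y t a) (p.Y_pos t a).ne' : ℝ × ℝ →L[ℝ] ℝ × ℝ) (t, a) :=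
    hasFDerivAt_fst.prodMk hX
  have hgraph : HasFDerivAt (fun q : ℝ × ℝ => (q.1, p.label q.1 q.2)) _ (t, x) :=
    HasFDerivAt.of_local_left_inverse (continuous_fst.prodMk p.continuous_label).continuousAt
      hXgraph (Eventually.of_forall fun q => Prod.ext rfl (p.X_label q.1 q.2))
  have hline : HasDerivAt (fun τ => (τ, p.label τ x)) (1, -(p.U t a * (p.Y t a)⁻¹)) t :=
    (hgraph.comp_hasDerivAt t ((hasDerivAt_id t).prodMk (hasDerivAt_const t x))).congr_deriv
      (by simp [shearEquiv, mul_comm])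
  exact hline.snd

end ParticleFlow

theorem HasBddDerivs.comp_label {d : LagrangianData} {k ν T : ℝ} {f ft fa : ℝ → ℝ → ℝ}
    (hf : HasBddDerivs T f ft fa) (p : ParticleFlow d k ν T) :
    HasBddDerivs T (fun t x => f t (p.label t x))
      (fun t x => ft t (p.label t x) -
        p.U t (p.label t x) * (fa t (p.label t x) * (p.Y t (p.label t x))⁻¹))
      fun t x => fa t (p.label t x) * (p.Y t (p.label t x))⁻¹ where
  hasDerivAt_time t ht x := by
    have hF := hasFDerivAt_uncurry_of_mem_Ioo hf.hasDerivAt_time hf.hasDerivAt_space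
      hf.bdd_time.continuous hf.bdd_space.continuous ht (p.label t x)
    refine (hF.comp_hasDerivAt t ((hasDerivAt_id t).prodMk
      (p.hasDerivAt_label_time ht x))).congr_deriv ?_
    simp [sub_eq_add_neg, mul_left_comm]
  hasDerivAt_space t x := (hf.hasDerivAt_space t _).comp x (p.hasDerivAt_label_space t x)
  bdd := hf.bdd.comp p.continuous_label
  bdd_time := (hf.bdd_time.sub (p.bdd_U.mul (hf.bdd_space.mul p.bdd_inv_Y))).comp p.continuous_label
  bdd_space := (hf.bdd_space.mul p.bdd_inv_Y).comp p.continuous_label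

theorem eq_zero_of_tendsto_of_memLp {α E : Type*} [MeasurableSpace α] [NormedAddCommGroup E]
    {μ : Measure α} {l : Filter α} {p : ℝ≥0∞} {g : α → E} {b : E} (hp0 : p ≠ 0) (hp : p ≠ ⊤)
    (hl : ∀ s ∈ l, μ s = ⊤) (hg : MemLp g p μ) (hb : Tendsto g l (𝓝 b)) : b = 0 := by
  have hp' := ENNReal.toReal_pos hp0 hp
  have h := ((hg.integrable_norm_rpow hp0 hp).integrableAtFilter l).eq_zero_of_tendsto hl
    (hb.norm.rpow_const (Or.inr hp'.le))
  rwa [Real.rpow_eq_zero (norm_nonneg b) hp'.ne', norm_eq_zero] at h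

theorem volume_eq_top_of_mem_atBot {s : Set ℝ} (hs : s ∈ (atBot : Filter ℝ)) : volume s = ⊤ :=
  let ⟨_, ha⟩ := mem_atBot_sets.1 hs
  measure_mono_top (fun x hx => ha x hx) Real.volume_Iic

theorem volume_eq_top_of_mem_atTop {s : Set ℝ} (hs : s ∈ (atTop : Filter ℝ)) : volume s = ⊤ :=
  let ⟨_, ha⟩ := mem_atTop_sets.1 hs
  measure_mono_top (fun x hx => ha x hx) Real.volume_Ici

theorem integral_eq_zero_of_hasDerivAt_of_memLp {E : Type*} [NormedAddCommGroup E]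
    [NormedSpace ℝ E] [CompleteSpace E] {p : ℝ≥0∞} {g g' : ℝ → E} (hp0 : p ≠ 0) (hp : p ≠ ⊤)
    (hg : ∀ x, HasDerivAt g (g' x) x) (hg' : Integrable g') (hgp : MemLp g p) :
    ∫ x, g' x = 0 := by
  have hbot := tendsto_limUnder_of_hasDerivAt_of_integrableOn_Iic (a := 0)
    (fun x _ => hg x) hg'.integrableOn
  have htop := tendsto_limUnder_of_hasDerivAt_of_integrableOn_Ioi (a := 0)
    (fun x _ => hg x) hg'.integrableOn
  rw [integral_of_hasDerivAt_of_tendsto hg hg' hbot htop,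
    eq_zero_of_tendsto_of_memLp hp0 hp (fun _ => volume_eq_top_of_mem_atBot) hgp hbot,
    eq_zero_of_tendsto_of_memLp hp0 hp (fun _ => volume_eq_top_of_mem_atTop) hgp htop, sub_zero]

theorem spaceDeriv_eq {f fx : ℝ → ℝ → ℝ} (hfx : ∀ t x, HasDerivAt (f t) (fx t x) x) :
    spaceDeriv f = fx :=
  funext₂ fun t x => (hfx t x).deriv

namespace HasBddDerivs

variable {T t : ℝ} {f ft fx : ℝ → ℝ → ℝ}

theorem timeDeriv_eq (hf : HasBddDerivs T f ft fx) (ht : t ∈ Ico 0 T) (x : ℝ) :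
    timeDeriv T f t x = ft t x :=
  (hf.hasDerivAt_time t ⟨by linarith [ht.1, ht.2], ht.2⟩ x).hasDerivWithinAt.derivWithin
    (uniqueDiffOn_Ico 0 T t ht)

theorem isClassC1 (hf : HasBddDerivs T f ft fx) : IsClassC1 T f where
  diff_time t ht x := (hf.hasDerivAt_time t ⟨by linarith [ht.1, ht.2], ht.2⟩ x).differentiableAt
    |>.differentiableWithinAt
  diff_space t _ x := (hf.hasDerivAt_space t x).differentiableAt
  cont := hf.bdd.continuous.continuousOn
  cont_time := hf.bdd_time.continuous.continuousOn.congr fun z hz => hf.timeDeriv_eq hz.1 z.2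
  cont_space := by
    rw [spaceDeriv_eq hf.hasDerivAt_space]
    exact hf.bdd_space.continuous.continuousOn
  bounded T' hT' := by
    obtain ⟨B, hB⟩ := hf.bdd.bounded
    obtain ⟨Bt, hBt⟩ := hf.bdd_time.bounded
    obtain ⟨Bx, hBx⟩ := hf.bdd_space.bounded
    refine ⟨B + Bt + Bx, fun t ht x => ?_⟩
    rw [spaceDeriv_eq hf.hasDerivAt_space, hf.timeDeriv_eq ⟨ht.1, ht.2.trans_lt hT'.2⟩]
    exact add_le_add (add_le_add (hB t x) (hBt t x)) (hBx t x)

end HasBddDerivs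

theorem IsClassicalSolution.congr_background {k ν T : ℝ} {c c' ρ u : ℝ → ℝ → ℝ} {ρ₀ u₀ : ℝ → ℝ}
    (h : IsClassicalSolution k ν c ρ₀ u₀ T ρ u) (hc : ∀ t ∈ Ico 0 T, c t = c' t) :
    IsClassicalSolution k ν c' ρ₀ u₀ T ρ u where
  __ := h
  momentum_poisson :=
    let ⟨φ, hφ⟩ := h.momentum_poisson
    ⟨φ, fun t ht => hc t ht ▸ hφ t ht⟩
  neutrality t ht := hc t ht ▸ h.neutrality t ht

namespace ParticleFlow

variable {d : LagrangianData} {k ν T : ℝ} (p : ParticleFlow d k ν T)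

/-- The Eulerian velocity. -/
noncomputable def velocity (t x : ℝ) : ℝ := p.U t (p.label t x)

/-- The Eulerian density: mass conservation gives it the value `ρ₀ / ∂ₐX` along the flow. -/
noncomputable def density (t x : ℝ) : ℝ := d.ρ₀ (p.label t x) * (p.Y t (p.label t x))⁻¹

/-- The field `∂ₓφ`. As the flow conserves the mass between two particles, `m (label t x)` is a
primitive of the density, and the field is a primitive of `c - ρ`. -/
noncomputable def field (t x : ℝ) : ℝ := d.Γ t x - d.m (p.label t x)

theorem abs_m_X_sub_le (t a : ℝ) : |d.m (p.X t a) - d.m a| ≤ d.κ * |p.X t a - a| :=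
  abs_sub_le_of_abs_deriv_le d.hasDerivAt_m d.abs_ρ₀_le a (p.X t a)

theorem continuous_m_X_sub : Continuous (Function.uncurry fun t a => d.m (p.X t a) - d.m a) := by
  have cX := p.continuous_X
  have cm := d.continuous_m
  fun_prop

theorem bdd_field_X : BddContinuous fun t a => d.Γ t (p.X t a) - d.m a := by
  have hm : BddContinuous fun t a => d.m (p.X t a) - d.m a :=
    (p.bdd_X_sub_id.const_mul d.κ).mono p.continuous_m_X_sub fun t a => by
      rw [abs_mul, NNReal.abs_eq]
      exact p.abs_m_X_sub_le t a
  simpa using (d.bdd_field.comp p.continuous_X).add hm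

theorem bddInLp_field_X : BddInLp 2 fun t a => d.Γ t (p.X t a) - d.m a := by
  have hm : BddInLp 2 fun t a => d.m (p.X t a) - d.m a :=
    (p.bddInLp_X_sub_id.abs.const_mul d.κ).mono p.continuous_m_X_sub p.abs_m_X_sub_le
  simpa using (d.bddInLp_field.comp ENNReal.ofNat_ne_top p.continuous_X
    p.antilipschitzWith_X).add one_le_two hm

theorem bddInLp_field : BddInLp 2 p.field := by
  convert p.bddInLp_field_X.comp ENNReal.ofNat_ne_top p.continuous_label
    p.antilipschitzWith_label using 3
  rw [field, X_label]

theorem hasBddDerivs_U : HasBddDerivs T p.U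
    (fun t a => -ν * p.U t a + -k * (d.Γ t (p.X t a) - d.m a)) p.V where
  hasDerivAt_time _ ht a := ((p.hasVelocityOn a).hasDerivAt ht).snd
  hasDerivAt_space := p.hasDerivAt_U
  bdd := p.bdd_U
  bdd_time := (p.bdd_U.const_mul (-ν)).add (p.bdd_field_X.const_mul (-k))
  bdd_space := p.bdd_V

/-- The gradient `∂ₓu` of the Eulerian velocity. -/
noncomputable def velocityGrad (t x : ℝ) : ℝ := p.V t (p.label t x) * (p.Y t (p.label t x))⁻¹

theorem hasBddDerivs_velocity : HasBddDerivs T p.velocity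
    (fun t x => -ν * p.velocity t x + -k * p.field t x - p.velocity t x * p.velocityGrad t x)
    p.velocityGrad := by
  have h := p.hasBddDerivs_U.comp_label p
  simp only [X_label] at h
  exact h

theorem hasBddDerivs_ρ₀_mul_inv_Y : HasBddDerivs T (fun t a => d.ρ₀ a * (p.Y t a)⁻¹)
    (fun t a => -1 * (d.ρ₀ a * (p.V t a * ((p.Y t a)⁻¹ * (p.Y t a)⁻¹))))
    fun t a => d.ρ₁ a * (p.Y t a)⁻¹ - d.ρ₀ a * (p.Z t a * ((p.Y t a)⁻¹ * (p.Y t a)⁻¹)) where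
  hasDerivAt_time t ht a := by
    have hY : HasDerivAt (p.Y · a) (p.V t a) t := ((p.hasVelocityOn_deriv a).hasDerivAt ht).fst
    refine ((hY.fun_inv (p.Y_pos t a).ne').const_mul (d.ρ₀ a)).congr_deriv ?_
    ring
  hasDerivAt_space t a := by
    refine ((d.hasDerivAt_ρ₀ a).mul
      ((p.hasDerivAt_Y t a).fun_inv (p.Y_pos t a).ne')).congr_deriv ?_
    ring
  bdd := d.bdd_ρ₀.mul p.bdd_inv_Y
  bdd_time := (d.bdd_ρ₀.mul (p.bdd_V.mul (p.bdd_inv_Y.mul p.bdd_inv_Y))).const_mul (-1)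
  bdd_space := (d.bdd_ρ₁.mul p.bdd_inv_Y).sub
    (d.bdd_ρ₀.mul (p.bdd_Z.mul (p.bdd_inv_Y.mul p.bdd_inv_Y)))

/-- The gradient `∂ₓρ` of the Eulerian density. -/
noncomputable def densityGrad (t x : ℝ) : ℝ :=
  (d.ρ₁ (p.label t x) * (p.Y t (p.label t x))⁻¹ - d.ρ₀ (p.label t x) * (p.Z t (p.label t x) *
    ((p.Y t (p.label t x))⁻¹ * (p.Y t (p.label t x))⁻¹))) * (p.Y t (p.label t x))⁻¹

theorem hasBddDerivs_density : HasBddDerivs T p.density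
    (fun t x => -(p.density t x * p.velocityGrad t x) - p.velocity t x * p.densityGrad t x)
    p.densityGrad := by
  convert p.hasBddDerivs_ρ₀_mul_inv_Y.comp_label p using 3
  · rfl
  · simp only [density, velocityGrad, velocity, densityGrad]
    ring
  · rfl

theorem hasDerivAt_field (t x : ℝ) : HasDerivAt (p.field t) (d.c t x - p.density t x) x :=
  (d.hasDerivAt_Γ t x).sub ((d.hasDerivAt_m _).comp x (p.hasDerivAt_label_space t x))

theorem bddInLp_density_sub : BddInLp 1 fun t x => p.density t x - d.c t x := by
  have hLagrangian : BddInLp 1 fun t a => (p.Y t a)⁻¹ * (-1 * (d.c t (p.X t a) - d.ρ₀ a) -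
      d.c t (p.X t a) * (p.Y t a - 1)) :=
    .bdd_mul p.bdd_inv_Y ((p.bddInLp_c_X_sub.const_mul (-1)).sub le_rfl
      (.bdd_mul (d.bdd_c.comp p.continuous_X) p.bddInLp_Y_sub_one))
  convert hLagrangian.comp ENNReal.one_ne_top p.continuous_label p.antilipschitzWith_label using 3
    with t x
  have hY := (p.Y_pos t (p.label t x)).ne'
  rw [density, X_label]
  field_simp
  ring

theorem bddInLp_spaceDeriv_velocity : BddInLp 1 (spaceDeriv p.velocity) := by
  rw [spaceDeriv_eq p.hasBddDerivs_velocity.hasDerivAt_space]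
  convert (BddInLp.bdd_mul p.bdd_inv_Y p.bddInLp_V).comp ENNReal.one_ne_top
    p.continuous_label p.antilipschitzWith_label using 3
  rw [velocityGrad, mul_comm]

theorem momentum_poisson : ∃ φ : ℝ → ℝ → ℝ, ∀ t ∈ Ico 0 T,
    Differentiable ℝ (φ t) ∧ Differentiable ℝ (spaceDeriv φ t) ∧ MemLp (spaceDeriv φ t) 2 ∧
    (∀ x, -spaceDeriv (spaceDeriv φ) t x = p.density t x - d.c t x) ∧
    ∀ x, timeDeriv T p.velocity t x + p.velocity t x * spaceDeriv p.velocity t x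
      = -ν * p.velocity t x - k * spaceDeriv φ t x := by
  have hφ : ∀ t x, HasDerivAt (fun x => ∫ y in (0 : ℝ)..x, p.field t y) (p.field t x) x :=
    fun t x => ((p.bddInLp_field.continuous_slice t).integral_hasStrictDerivAt 0 x).hasDerivAt
  refine ⟨fun t x => ∫ y in (0 : ℝ)..x, p.field t y, fun t ht => ?_⟩
  rw [spaceDeriv_eq hφ, spaceDeriv_eq p.hasDerivAt_field,
    spaceDeriv_eq p.hasBddDerivs_velocity.hasDerivAt_space]
  refine ⟨fun x => (hφ t x).differentiableAt, fun x => (p.hasDerivAt_field t x).differentiableAt,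
    p.bddInLp_field.memLp t, fun x => neg_sub _ _, fun x => ?_⟩
  rw [p.hasBddDerivs_velocity.timeDeriv_eq ht]
  ring

theorem continuity_eq {t : ℝ} (ht : t ∈ Ico 0 T) (x : ℝ) : timeDeriv T p.density t x +
    spaceDeriv (fun τ y => p.density τ y * p.velocity τ y) t x = 0 := by
  have hflux := (p.hasBddDerivs_density.hasDerivAt_space t x).fun_mul
    (p.hasBddDerivs_velocity.hasDerivAt_space t x)
  rw [p.hasBddDerivs_density.timeDeriv_eq ht, spaceDeriv, hflux.deriv]
  ring

theorem integral_density_sub (t : ℝ) : ∫ x, (p.density t x - d.c t x) = 0 := by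
  have hint : Integrable fun x => d.c t x - p.density t x := by
    simpa [Pi.neg_def] using (memLp_one_iff_integrable.1 (p.bddInLp_density_sub.memLp t)).neg
  have h := integral_eq_zero_of_hasDerivAt_of_memLp two_ne_zero ENNReal.ofNat_ne_top
    (p.hasDerivAt_field t) hint (p.bddInLp_field.memLp t)
  rw [← neg_eq_zero, ← integral_neg]
  simpa using h

theorem isClassicalSolution :
    IsClassicalSolution k ν d.c d.ρ₀ d.u₀ T p.density p.velocity where
  density_C1 := p.hasBddDerivs_density.isClassC1
  velocity_C1 := p.hasBddDerivs_velocity.isClassC1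
  continuity_eq _ ht := p.continuity_eq ht
  momentum_poisson := p.momentum_poisson
  initial_density x := by simp [density, label_zero, Y_zero]
  initial_velocity x := by rw [velocity, label_zero, U_zero]
  neutrality t _ := ⟨memLp_one_iff_integrable.1 (p.bddInLp_density_sub.memLp t),
    p.integral_density_sub t⟩

theorem iSup_eLpNorm_lt_top : (⨆ t ∈ Ico (0 : ℝ) T, (eLpNorm (fun x => p.density t x - d.c t x) 1 +
    eLpNorm (spaceDeriv p.velocity t) 1)) < ⊤ := by
  obtain ⟨A, hA⟩ := p.bddInLp_density_sub.bounded
  obtain ⟨B, hB⟩ := p.bddInLp_spaceDeriv_velocity.bounded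
  exact (iSup₂_le fun t _ => add_le_add (hA t) (hB t)).trans_lt
    (ENNReal.add_lt_top.2 ⟨ENNReal.coe_lt_top, ENNReal.coe_lt_top⟩)

end ParticleFlow

/-! ### Functions of finite Sobolev norm -/

section FourierInversion

variable {V E F : Type*} [NormedAddCommGroup V] [InnerProductSpace ℝ V] [FiniteDimensional ℝ V]
  [MeasurableSpace V] [BorelSpace V] [NormedAddCommGroup E] [NormedSpace ℂ E]
  [NormedAddCommGroup F] [InnerProductSpace ℂ F] [CompleteSpace F]

theorem continuous_fourierInv {h : V → E} (hh : Integrable h) : Continuous (𝓕⁻ h) := by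
  rw [Real.fourierInv_eq_fourier_comp_neg]
  exact VectorFourier.fourierIntegral_continuous Real.continuous_fourierChar (L := innerₗ V)
    continuous_inner hh.comp_neg

theorem enorm_fourierInv_le (h : V → E) (x : V) : ‖𝓕⁻ h x‖ₑ ≤ eLpNorm h 1 := by
  rw [Real.fourierInv_eq, eLpNorm_one_eq_lintegral_enorm]
  refine (enorm_integral_le_lintegral_enorm _).trans_eq (lintegral_congr fun ξ => ?_)
  rw [← ofReal_norm, Circle.norm_smul, ofReal_norm]

theorem coeFn_fourierInv_ae_eq (h : Lp F 2 (volume : Measure V)) (hh : Integrable h) :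
    (𝓕⁻ h : Lp F 2 (volume : Measure V)) =ᵐ[volume] 𝓕⁻ (h : V → F) := by
  refine ae_eq_of_integral_contDiff_smul_eq ((Lp.memLp _).locallyIntegrable one_le_two)
    (continuous_fourierInv hh).locallyIntegrable fun g hg hgs => ?_
  have hgs' : HasCompactSupport (Complex.ofRealCLM ∘ g) := hgs.comp_left rfl
  let φ : SchwartzMap V ℂ := hgs'.toSchwartzMap (Complex.ofRealCLM.contDiff.comp hg)
  have hdist := congrArg (fun S => S φ) (Lp.fourierInv_toTemperedDistribution_eq h)
  simp only [TemperedDistribution.fourierInv_apply, Lp.toTemperedDistribution_apply,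
    SchwartzMap.fourierInv_coe] at hdist
  have hflip : (-(innerₗ V)).flip = (-(innerₗ V) : V →ₗ[ℝ] V →ₗ[ℝ] ℝ) := by
    ext x y
    simp [real_inner_comm]
  have hself := VectorFourier.integral_fourierIntegral_smul_eq_flip (L := -(innerₗ V))
    (μ := volume) (ν := volume) (f := φ) (g := (h : V → F)) Real.continuous_fourierChar
    (continuous_inner (𝕜 := ℝ) (E := V)).neg φ.integrable hh
  rw [hflip] at hself
  have hφ' (G : V → F) : ∫ x, φ x • G x = ∫ x, g x • G x :=
    integral_congr_ae (Eventually.of_forall fun x => by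
      change (g x : ℂ) • G x = g x • G x
      simp)
  have hφh : ∫ x, φ x • (𝓕⁻ h : Lp F 2 (volume : Measure V)) x
      = ∫ x, φ x • (𝓕⁻ (h : V → F)) x := by
    rw [← hdist]
    convert! hself using 2
  exact (hφ' _).symm.trans (hφh.trans (hφ' _))

theorem eLpNorm_fourierInv {h : V → F} (h₁ : Integrable h) (h₂ : MemLp h 2) :
    eLpNorm (𝓕⁻ h) 2 = eLpNorm h 2 := by
  have hae := h₂.coeFn_toLp
  have hcongr : 𝓕⁻ (h₂.toLp h : V → F) = 𝓕⁻ h := funext (Real.fourierInv_congr_ae hae)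
  have hinv := coeFn_fourierInv_ae_eq (h₂.toLp h) (h₁.congr hae.symm)
  have hnorm : ‖(𝓕⁻ (h₂.toLp h) : Lp F 2 (volume : Measure V))‖ = ‖h₂.toLp h‖ :=
    (Lp.fourierTransformₗᵢ V F).symm.norm_map (h₂.toLp h)
  rw [← hcongr, ← eLpNorm_congr_ae hinv, ← Lp.enorm_def, ← ofReal_norm, hnorm, ofReal_norm,
    Lp.enorm_def, eLpNorm_congr_ae hae]

end FourierInversion

theorem hasDerivAt_fourierInv {E : Type*} [NormedAddCommGroup E] [NormedSpace ℂ E] {h : ℝ → E}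
    (h₀ : Integrable h) (h₁ : Integrable fun ξ : ℝ => ξ • h ξ) (x : ℝ) :
    HasDerivAt (𝓕⁻ h) (𝓕⁻ (fun ξ : ℝ => (2 * Real.pi * Complex.I * ξ) • h ξ) x) x := by
  have hneg (f : ℝ → E) : 𝓕⁻ f = fun x => 𝓕 f (-x) :=
    funext (Real.fourierInv_eq_fourier_neg f)
  rw [hneg h, hneg]
  refine ((Real.hasDerivAt_fourier h₀ h₁ (-x)).scomp x (hasDerivAt_neg x)).congr_deriv ?_
  change _ = 𝓕 (fun ξ : ℝ => (2 * Real.pi * Complex.I * ξ) • h ξ) (-x)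
  rw [neg_one_smul, Real.fourier_eq, Real.fourier_eq, ← integral_neg]
  refine integral_congr_ae (Eventually.of_forall fun ξ => ?_)
  simp only [neg_mul, neg_smul, smul_neg, neg_neg]

/-- The symbol `(2πiξ)^j h(ξ)` of the `j`-th derivative of the function with Fourier transform `h`;
for `j = -1` it is the symbol of an antiderivative. -/
noncomputable def derivSymbol (h : ℝ → ℂ) (j : ℤ) (ξ : ℝ) : ℂ :=
  (2 * Real.pi * Complex.I * ξ) ^ j * h ξ

/-- The `j`-th derivative of the real function with Fourier transform `h`. -/
noncomputable def fourierDeriv (h : ℝ → ℂ) (j : ℤ) (x : ℝ) : ℝ := (𝓕⁻ (derivSymbol h j) x).re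

section FourierDeriv

variable {h : ℝ → ℂ} {j : ℤ}

theorem derivSymbol_zero (h : ℝ → ℂ) : derivSymbol h 0 = h :=
  funext fun _ => by rw [derivSymbol, zpow_zero, one_mul]

theorem norm_derivSymbol (h : ℝ → ℂ) (j : ℤ) (ξ : ℝ) :
    ‖derivSymbol h j ξ‖ = (2 * Real.pi * |ξ|) ^ j * ‖h ξ‖ := by
  simp [derivSymbol, abs_of_pos Real.pi_pos]

theorem aestronglyMeasurable_derivSymbol (hm : AEStronglyMeasurable h) (j : ℤ) :
    AEStronglyMeasurable (derivSymbol h j) :=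
  (by fun_prop : Measurable fun ξ : ℝ =>
    (2 * Real.pi * Complex.I * ξ : ℂ) ^ j).aestronglyMeasurable.mul hm

theorem derivSymbol_add_one_ae_eq (h : ℝ → ℂ) (j : ℤ) : derivSymbol h (j + 1) =ᵐ[volume]
    fun ξ => (2 * Real.pi * Complex.I * ξ) • derivSymbol h j ξ := by
  filter_upwards [compl_mem_ae_iff.2 (measure_singleton (0 : ℝ))] with ξ hξ
  have hξ' : (2 * Real.pi * Complex.I * ξ : ℂ) ≠ 0 := by
    have : ξ ≠ 0 := hξ
    simpa
  rw [derivSymbol, derivSymbol, zpow_add_one₀ hξ', smul_eq_mul]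
  ring

theorem continuous_fourierDeriv (hj : Integrable (derivSymbol h j)) :
    Continuous (fourierDeriv h j) :=
  Complex.continuous_re.comp (continuous_fourierInv hj)

theorem enorm_fourierDeriv_le (h : ℝ → ℂ) (j : ℤ) (x : ℝ) :
    ‖fourierDeriv h j x‖ₑ ≤ eLpNorm (derivSymbol h j) 1 :=
  (enorm_le_iff_norm_le.2 (Complex.abs_re_le_norm _)).trans (enorm_fourierInv_le _ x)

theorem memLp_fourierDeriv (h₁ : Integrable (derivSymbol h j)) (h₂ : MemLp (derivSymbol h j) 2) :
    MemLp (fourierDeriv h j) 2 ∧ eLpNorm (fourierDeriv h j) 2 ≤ eLpNorm (derivSymbol h j) 2 := by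
  have hle : eLpNorm (fourierDeriv h j) 2 ≤ eLpNorm (derivSymbol h j) 2 :=
    (eLpNorm_mono fun x => Complex.abs_re_le_norm _).trans_eq (eLpNorm_fourierInv h₁ h₂)
  exact ⟨⟨(continuous_fourierDeriv h₁).aestronglyMeasurable, hle.trans_lt h₂.2⟩, hle⟩

theorem hasDerivAt_fourierDeriv (hj : Integrable (derivSymbol h j))
    (hj' : Integrable (derivSymbol h (j + 1))) (x : ℝ) :
    HasDerivAt (fourierDeriv h j) (fourierDeriv h (j + 1) x) x := by
  have hae := derivSymbol_add_one_ae_eq h j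
  have hξ : Integrable fun ξ : ℝ => ξ • derivSymbol h j ξ := by
    refine ((hj'.congr hae).const_mul (2 * Real.pi * Complex.I)⁻¹).congr
      (Eventually.of_forall fun ξ => ?_)
    simp only [smul_eq_mul, Complex.real_smul]
    field_simp
  have hd := hasDerivAt_fourierInv hj hξ x
  rw [← Real.fourierInv_congr_ae hae] at hd
  exact Complex.reCLM.hasFDerivAt.comp_hasDerivAt x hd

theorem integrable_derivSymbol_neg_one (h₁ : Integrable h)
    (h₂ : MemLp (derivSymbol h (-1)) 2) : Integrable (derivSymbol h (-1)) := by
  have hlow : IntegrableOn (fun ξ => ‖derivSymbol h (-1) ξ‖) (Icc (-1) 1) :=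
    ((h₂.locallyIntegrable one_le_two).integrableOn_isCompact isCompact_Icc).norm
  refine ((hlow.integrable_indicator measurableSet_Icc).add h₁.norm).mono' h₂.1
    (Eventually.of_forall fun ξ => ?_)
  rw [Pi.add_apply]
  by_cases hξ : ξ ∈ Icc (-1 : ℝ) 1
  · rw [indicator_of_mem hξ]
    exact le_add_of_nonneg_right (norm_nonneg _)
  · have hξ' : 1 < |ξ| := not_le.1 fun hle => hξ (abs_le.1 hle)
    rw [indicator_of_notMem hξ, zero_add, norm_derivSymbol, zpow_neg_one]
    refine mul_le_of_le_one_left (norm_nonneg _) (inv_le_one_of_one_le₀ ?_)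
    nlinarith [Real.pi_gt_three]

theorem memLp_one_add_sq_rpow_neg_half :
    MemLp (fun ξ : ℝ => (1 + |ξ| ^ 2) ^ (-(1 / 2) : ℝ)) 2 := by
  have hc : Continuous fun ξ : ℝ => (1 + |ξ| ^ 2) ^ (-(1 / 2) : ℝ) :=
    (by fun_prop : Continuous fun ξ : ℝ => 1 + |ξ| ^ 2).rpow_const
      fun ξ => Or.inl (by positivity)
  rw [memLp_two_iff_integrable_sq hc.aestronglyMeasurable]
  refine integrable_inv_one_add_sq.congr (Eventually.of_forall fun ξ => ?_)
  simp only [sq_abs]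
  rw [← Real.rpow_mul_natCast (by positivity), ← Real.rpow_neg_one]
  norm_num

theorem abs_pow_le_one_add_sq_rpow {s : ℝ} {n : ℕ} (hs : n + 1 ≤ s) (ξ : ℝ) :
    |ξ| ^ n ≤ (1 + |ξ| ^ 2) ^ (-(1 / 2) : ℝ) * (1 + |ξ| ^ 2) ^ (s / 2) := by
  have hone : (1 : ℝ) ≤ 1 + |ξ| ^ 2 := le_add_of_nonneg_right (sq_nonneg _)
  rw [← Real.rpow_add (by positivity)]
  calc |ξ| ^ n = (|ξ| ^ 2) ^ (n / 2 : ℝ) := by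
        rw [← Real.rpow_natCast_mul (abs_nonneg _), ← Real.rpow_natCast]
        congr 1
        push_cast
        ring
    _ ≤ (1 + |ξ| ^ 2) ^ (n / 2 : ℝ) :=
        Real.rpow_le_rpow (by positivity) (le_add_of_nonneg_left zero_le_one) (by positivity)
    _ ≤ _ := Real.rpow_le_rpow_of_exponent_le hone (by linarith)

theorem exists_eLpNorm_derivSymbol_le (n : ℕ) : ∃ C : ℝ≥0, ∀ {s : ℝ}, n + 1 ≤ s →
    ∀ {h : ℝ → ℂ}, AEStronglyMeasurable h → eLpNorm (derivSymbol h n) 1 ≤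
      C * eLpNorm (fun ξ : ℝ => (((1 + |ξ| ^ 2) ^ (s / 2) : ℝ) : ℂ) * h ξ) 2 := by
  let w : ℝ → ℝ := fun ξ => (2 * Real.pi) ^ n * (1 + |ξ| ^ 2) ^ (-(1 / 2) : ℝ)
  have hw : MemLp w 2 := memLp_one_add_sq_rpow_neg_half.const_mul _
  refine ⟨(eLpNorm w 2).toNNReal, fun {s} hs {h} hm => ?_⟩
  rw [ENNReal.coe_toNNReal hw.eLpNorm_ne_top]
  have hws : Continuous fun ξ : ℝ => (1 + |ξ| ^ 2) ^ (s / 2) :=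
    (by fun_prop : Continuous fun ξ : ℝ => 1 + |ξ| ^ 2).rpow_const
      fun ξ => Or.inl (by positivity)
  refine (eLpNorm_mono fun ξ => ?_).trans (eLpNorm_smul_le_mul_eLpNorm (p := 2) (q := 2) (r := 1)
    ((Complex.continuous_ofReal.comp hws).aestronglyMeasurable.mul hm) hw.1)
  calc ‖derivSymbol h n ξ‖ = (2 * Real.pi) ^ n * |ξ| ^ n * ‖h ξ‖ := by
        rw [norm_derivSymbol, zpow_natCast, mul_pow]
    _ ≤ (2 * Real.pi) ^ n * ((1 + |ξ| ^ 2) ^ (-(1 / 2) : ℝ) * (1 + |ξ| ^ 2) ^ (s / 2)) * ‖h ξ‖ := by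
        gcongr
        exact abs_pow_le_one_add_sq_rpow hs ξ
    _ = w ξ * ((1 + |ξ| ^ 2) ^ (s / 2) * ‖h ξ‖) := by
        simp only [w]
        ring
    _ = ‖w ξ‖ * ‖(((1 + |ξ| ^ 2) ^ (s / 2) : ℝ) : ℂ) * h ξ‖ := by
        rw [norm_mul (Complex.ofReal _), Complex.norm_real, Real.norm_of_nonneg,
          Real.norm_of_nonneg] <;> positivity
    _ = _ := by rw [Pi.smul_apply', norm_smul]; rfl

end FourierDeriv

section Sobolev

variable {s : ℝ} {f : ℝ → ℝ} {M : ℝ≥0}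

/-- The Plancherel transform entering `sobolevENorm` and `homSobolevNegOneENorm`. -/
noncomputable def fourierL2 {f : ℝ → ℝ} (hf : MemLp (fun x => (f x : ℂ)) 2) :
    Lp ℂ 2 (volume : Measure ℝ) := 𝓕 (hf.toLp _)

theorem memLp_ofReal_of_sobolevENorm_lt_top (h : sobolevENorm s f < ⊤) :
    MemLp (fun x => (f x : ℂ)) 2 := by
  by_contra hf
  simp [sobolevENorm, hf] at h

theorem sobolevENorm_eq (hf : MemLp (fun x => (f x : ℂ)) 2) : sobolevENorm s f =
    eLpNorm (fun ξ : ℝ => (((1 + |ξ| ^ 2) ^ (s / 2) : ℝ) : ℂ) * fourierL2 hf ξ) 2 :=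
  dif_pos hf

theorem homSobolevNegOneENorm_eq (hf : MemLp (fun x => (f x : ℂ)) 2) : homSobolevNegOneENorm f =
    eLpNorm (fun ξ : ℝ => ((|ξ|⁻¹ : ℝ) : ℂ) * fourierL2 hf ξ) 2 :=
  dif_pos hf

theorem memLp_of_sobolevENorm_le (hs : 0 ≤ s) (hM : sobolevENorm s f ≤ M) :
    MemLp f 2 ∧ eLpNorm f 2 ≤ M := by
  have hf := memLp_ofReal_of_sobolevENorm_lt_top (hM.trans_lt ENNReal.coe_lt_top)
  have hweight : eLpNorm (fourierL2 hf) 2 ≤ sobolevENorm s f := by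
    rw [sobolevENorm_eq hf]
    refine eLpNorm_mono fun ξ => ?_
    rw [norm_mul, Complex.norm_real, Real.norm_of_nonneg (by positivity)]
    exact le_mul_of_one_le_left (norm_nonneg _)
      (Real.one_le_rpow (le_add_of_nonneg_right (sq_nonneg _)) (by positivity))
  have hplancherel : eLpNorm f 2 = eLpNorm (fourierL2 hf) 2 := by
    rw [fourierL2, ← Lp.enorm_def, ← ofReal_norm, Lp.norm_fourier_eq, ofReal_norm, Lp.enorm_def,
      eLpNorm_congr_ae hf.coeFn_toLp]
    exact eLpNorm_congr_norm_ae (Eventually.of_forall fun x => (Complex.norm_real _).symm)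
  exact ⟨hf.re, hplancherel.trans_le (hweight.trans hM)⟩

theorem ae_eq_fourierDeriv_zero (hf : MemLp (fun x => (f x : ℂ)) 2)
    (hint : Integrable (fourierL2 hf)) : f =ᵐ[volume] fourierDeriv (fourierL2 hf) 0 := by
  filter_upwards [hf.coeFn_toLp, coeFn_fourierInv_ae_eq _ hint] with x hx hinv
  rw [fourierDeriv, derivSymbol_zero, ← hinv, fourierL2, FourierTransform.fourierInv_fourier_eq, hx,
    Complex.ofReal_re]

/-- The successive derivatives `g j`, `j ≤ n`, of the continuous representative `g 0` of a function
`f` of class `H^s`, `s ≥ n + 1`, with the common bound `C`. -/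
structure HasSobolevDerivs (n : ℕ) (C : ℝ) (f : ℝ → ℝ) (g : ℕ → ℝ → ℝ) : Prop where
  ae_eq : f =ᵐ[volume] g 0
  continuous : ∀ j ≤ n, Continuous (g j)
  abs_le : ∀ j ≤ n, ∀ x, |g j x| ≤ C
  hasDerivAt : ∀ j < n, ∀ x, HasDerivAt (g j) (g (j + 1) x) x

theorem exists_forall_hasSobolevDerivs (n : ℕ) : ∃ C : ℝ≥0, ∀ {s : ℝ}, n + 1 ≤ s →
    ∀ {f : ℝ → ℝ} {M : ℝ≥0}, sobolevENorm s f ≤ M → ∃ g, HasSobolevDerivs n (C * M) f g := by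
  choose K hK using exists_eLpNorm_derivSymbol_le
  refine ⟨∑ j ∈ Finset.range (n + 1), K j, fun {s} hs {f M} hM => ?_⟩
  have hf := memLp_ofReal_of_sobolevENorm_lt_top (hM.trans_lt ENNReal.coe_lt_top)
  have hm : AEStronglyMeasurable (fourierL2 hf) := (Lp.memLp _).1
  have hle {j : ℕ} (hj : j ≤ n) : eLpNorm (derivSymbol (fourierL2 hf) j) 1 ≤
      ((∑ i ∈ Finset.range (n + 1), K i) * M : ℝ≥0) := by
    have hjs : (j : ℝ) + 1 ≤ s := (add_le_add_left (Nat.cast_le.2 hj) 1).trans hs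
    refine (hK j hjs hm).trans ?_
    rw [← sobolevENorm_eq hf, ENNReal.coe_mul]
    gcongr
    exact Finset.single_le_sum_of_canonicallyOrdered (Finset.mem_range_succ_iff.2 hj)
  have hint {j : ℕ} (hj : j ≤ n) : Integrable (derivSymbol (fourierL2 hf) j) :=
    memLp_one_iff_integrable.1
      ⟨aestronglyMeasurable_derivSymbol hm _, (hle hj).trans_lt ENNReal.coe_lt_top⟩
  refine ⟨fun j => fourierDeriv (fourierL2 hf) j, ?_, fun j hj => continuous_fourierDeriv (hint hj),
    fun j hj x => ?_, fun j hj => hasDerivAt_fourierDeriv (hint hj.le) (hint hj)⟩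
  · refine ae_eq_fourierDeriv_zero hf ?_
    simpa only [Nat.cast_zero, derivSymbol_zero] using hint n.zero_le
  · have := (enorm_fourierDeriv_le (fourierL2 hf) j x).trans (hle hj)
    rw [← NNReal.coe_mul, ← Real.norm_eq_abs]
    exact_mod_cast this

theorem exists_hasDerivAt_neg_one_of_homSobolev (hs : 1 ≤ s) (hf : sobolevENorm s f < ⊤)
    (hM : homSobolevNegOneENorm f ≤ M) : ∃ g g' : ℝ → ℝ, (∀ x, HasDerivAt g (g' x) x) ∧
      Continuous g' ∧ f =ᵐ[volume] g' ∧ MemLp g 2 ∧ eLpNorm g 2 ≤ M := by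
  have hf2 := memLp_ofReal_of_sobolevENorm_lt_top hf
  have hm : AEStronglyMeasurable (fourierL2 hf2) := (Lp.memLp _).1
  have h0 : Integrable (fourierL2 hf2) := by
    obtain ⟨K, hK⟩ := exists_eLpNorm_derivSymbol_le 0
    have hle := hK (s := s) (by simpa using hs) hm
    rw [← sobolevENorm_eq hf2, Nat.cast_zero, derivSymbol_zero] at hle
    exact memLp_one_iff_integrable.1 ⟨hm, hle.trans_lt (ENNReal.mul_lt_top ENNReal.coe_lt_top hf)⟩
  have hsymbol : eLpNorm (derivSymbol (fourierL2 hf2) (-1)) 2 ≤ M := by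
    refine (eLpNorm_mono fun ξ => ?_).trans ((homSobolevNegOneENorm_eq hf2).symm.trans_le hM)
    rw [norm_derivSymbol, zpow_neg_one, mul_inv, norm_mul, Complex.norm_real, norm_inv,
      Real.norm_eq_abs, abs_abs, mul_assoc]
    exact mul_le_of_le_one_left (by positivity)
      (inv_le_one_of_one_le₀ (by nlinarith [Real.pi_gt_three]))
  have hL2 : MemLp (derivSymbol (fourierL2 hf2) (-1)) 2 :=
    ⟨aestronglyMeasurable_derivSymbol hm _, hsymbol.trans_lt ENNReal.coe_lt_top⟩
  have hneg := integrable_derivSymbol_neg_one h0 hL2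
  have h0' : Integrable (derivSymbol (fourierL2 hf2) (-1 + 1)) := by
    rwa [neg_add_cancel, derivSymbol_zero]
  have hmem := memLp_fourierDeriv hneg hL2
  refine ⟨_, _, hasDerivAt_fourierDeriv hneg h0', continuous_fourierDeriv h0', ?_, hmem.1,
    hmem.2.trans hsymbol⟩
  rw [neg_add_cancel]
  exact ae_eq_fourierDeriv_zero hf2 h0

theorem memLp_integral_Iic_of_homSobolev (hs : 1 ≤ s) (hf : Integrable f)
    (hsf : sobolevENorm s f < ⊤) (hM : homSobolevNegOneENorm f ≤ M) :
    MemLp (fun x => ∫ y in Iic x, f y) 2 ∧ eLpNorm (fun x => ∫ y in Iic x, f y) 2 ≤ M := by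
  obtain ⟨g, g', hg, hg'c, hfg, hg2⟩ := exists_hasDerivAt_neg_one_of_homSobolev hs hsf hM
  have hsub (x : ℝ) : (∫ y in Iic x, f y) - ∫ y in Iic 0, f y = g x - g 0 := by
    rw [intervalIntegral.integral_Iic_sub_Iic hf.integrableOn hf.integrableOn,
      intervalIntegral.integral_congr_ae_restrict (ae_restrict_of_ae hfg)]
    exact intervalIntegral.integral_eq_sub_of_hasDerivAt (fun z _ => hg z)
      (hg'c.intervalIntegrable _ _)
  have hlim : Tendsto g atBot (𝓝 (g 0 - ∫ y in Iic 0, f y)) := by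
    have h := (tendsto_integral_Iic_zero (f := f) (μ := volume) tendsto_id).add_const
      (g 0 - ∫ y in Iic 0, f y)
    rw [zero_add] at h
    exact h.congr fun x => by rw [id]; linarith [hsub x]
  have hzero := eq_zero_of_tendsto_of_memLp two_ne_zero ENNReal.ofNat_ne_top
    (fun _ => volume_eq_top_of_mem_atBot) hg2.1 hlim
  have hFg : (fun x => ∫ y in Iic x, f y) = g := funext fun x => by linarith [hsub x]
  rwa [hFg]

end Sobolev

theorem Icc_subset_closure_of_ae {a b : ℝ} (hab : a < b) {p : ℝ → Prop}
    (hp : ∀ᵐ t ∂(volume.restrict (Icc a b)), p t) : Icc a b ⊆ closure {t ∈ Icc a b | p t} := by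
  have hd : Dense {t | t ∈ Icc a b → p t} :=
    Measure.dense_of_ae ((ae_restrict_iff' measurableSet_Icc).1 hp)
  refine (closure_Ioo hab.ne).symm.subset.trans <| closure_minimal
    ((hd.open_subset_closure_inter isOpen_Ioo).trans (closure_mono ?_)) isClosed_closure
  exact fun t ht => ⟨Ioo_subset_Icc_self ht.1, ht.2 (Ioo_subset_Icc_self ht.1)⟩

/-! ### The background state and the initial data -/

/-- The first-order Taylor expansion `f (x + h) = f x + h f' x + O(h²)`, uniformly in `x`. Unlike a
bound on the second derivative, it obviously survives pointwise limits of `f` and `f'`. -/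
def HasTaylorBound (L : ℝ) (f f' : ℝ → ℝ) : Prop :=
  ∀ x h, |f (x + h) - f x - h * f' x| ≤ L * h ^ 2

namespace HasTaylorBound

variable {L : ℝ} {f f' f'' : ℝ → ℝ}

theorem of_hasDerivAt (hf : ∀ x, HasDerivAt f (f' x) x) (hf' : ∀ x, HasDerivAt f' (f'' x) x)
    (hL : ∀ x, |f'' x| ≤ L) : HasTaylorBound L f f' := by
  intro x h
  have hftc : ∫ y in x..x + h, (f' y - f' x) = f (x + h) - f x - h * f' x := by
    have hc := continuous_of_hasDerivAt hf'
    rw [intervalIntegral.integral_sub (hc.intervalIntegrable _ _) intervalIntegrable_const,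
      intervalIntegral.integral_eq_sub_of_hasDerivAt (fun y _ => hf y) (hc.intervalIntegrable _ _),
      intervalIntegral.integral_const, add_sub_cancel_left, smul_eq_mul]
  have hbound : ∀ y ∈ Ι x (x + h), ‖f' y - f' x‖ ≤ L * |h| := fun y hy => by
    refine (abs_sub_le_of_abs_deriv_le hf' hL x y).trans ?_
    have hyx := abs_sub_left_of_mem_uIcc (uIoc_subset_uIcc hy)
    rw [add_sub_cancel_left] at hyx
    exact mul_le_mul_of_nonneg_left hyx ((abs_nonneg _).trans (hL x))
  have := intervalIntegral.norm_integral_le_of_norm_le_const hbound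
  rwa [hftc, add_sub_cancel_left, mul_assoc, abs_mul_abs_self, ← sq] at this

theorem hasDerivAt (h : HasTaylorBound L f f') (x : ℝ) : HasDerivAt f (f' x) x := by
  rw [hasDerivAt_iff_isLittleO_nhds_zero]
  refine (Asymptotics.IsBigO.of_bound L (Eventually.of_forall fun y => ?_)).trans_isLittleO
    (Asymptotics.isLittleO_pow_id one_lt_two)
  simpa using h x y

theorem continuous_uncurry {F F' : ℝ → ℝ → ℝ} (hF : Continuous (Function.uncurry F))
    (h : ∀ t, HasTaylorBound L (F t) (F' t)) : Continuous (Function.uncurry F') := by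
  have hlim : TendstoUniformly (fun (y : ℝ) (z : ℝ × ℝ) => (F z.1 (z.2 + y) - F z.1 z.2) / y)
      (Function.uncurry F') (𝓝[≠] 0) := by
    rw [Metric.tendstoUniformly_iff]
    intro ε hε
    have hsmall : ∀ᶠ y in 𝓝[≠] (0 : ℝ), L * |y| < ε :=
      ((by fun_prop : Continuous fun y : ℝ => L * |y|).tendsto' 0 0 (by simp)).mono_left
        nhdsWithin_le_nhds |>.eventually_lt_const hε
    filter_upwards [hsmall, self_mem_nhdsWithin] with y hy hy0 z
    refine lt_of_le_of_lt ?_ hy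
    change dist (F' z.1 z.2) ((F z.1 (z.2 + y) - F z.1 z.2) / y) ≤ L * |y|
    rw [dist_comm, Real.dist_eq, div_sub' hy0, abs_div, div_le_iff₀ (abs_pos.2 hy0), mul_assoc,
      abs_mul_abs_self, ← sq]
    exact h z.1 z.2 y
  refine hlim.continuous (Eventually.of_forall fun y => ?_).frequently
  have hshift : Continuous fun z : ℝ × ℝ => F z.1 (z.2 + y) :=
    hF.comp (by fun_prop : Continuous fun z : ℝ × ℝ => (z.1, z.2 + y))
  exact (hshift.sub hF).div_const y

theorem exists_of_mem_closure {X : Type*} [TopologicalSpace X] {F : X → ℝ → ℝ} {S : Set X} {t : X}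
    (ht : t ∈ closure S) (hF : ∀ x, ContinuousWithinAt (fun τ => F τ x) S t)
    (hS : ∀ τ ∈ S, ∃ g, HasTaylorBound L (F τ) g ∧ ∀ x, |g x| ≤ L) :
    ∃ g, HasTaylorBound L (F t) g ∧ ∀ x, |g x| ≤ L := by
  choose! g hgT hgL using hS
  obtain ⟨U, hSU, hUt⟩ := mem_closure_iff_ultrafilter.1 ht
  have hFU (x : ℝ) : Tendsto (fun τ => F τ x) U (𝓝 (F t x)) :=
    (hF x).mono_left (le_inf hUt (le_principal_iff.2 hSU))
  have hcompact (x : ℝ) : ∃ y ∈ Icc (-L) L, Tendsto (fun τ => g τ x) U (𝓝 y) :=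
    isCompact_Icc.ultrafilter_le_nhds (U.map fun τ => g τ x)
      (le_principal_iff.2 <| Ultrafilter.mem_map.2 <|
        mem_of_superset hSU fun τ hτ => abs_le.1 (hgL τ hτ x))
  choose g' hg'L hg' using hcompact
  refine ⟨g', fun x h => ?_, fun x => abs_le.2 (hg'L x)⟩
  exact le_of_tendsto (((hFU (x + h)).sub (hFU x)).sub ((hg' x).const_mul h)).abs
    (mem_of_superset hSU fun τ hτ => hgT τ hτ x h)

end HasTaylorBound

theorem hasDerivAt_of_deriv_ae_eq {f g : ℝ → ℝ} (hf : Differentiable ℝ f) (hg : Continuous g)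
    (h : deriv f =ᵐ[volume] g) (x : ℝ) : HasDerivAt f (g x) x := by
  have hftc : f = fun y => f 0 + ∫ z in (0 : ℝ)..y, g z := by
    ext y
    rw [← intervalIntegral.integral_congr_ae_restrict (ae_restrict_of_ae h),
      intervalIntegral.integral_eq_sub_of_hasDerivAt (fun z _ => (hf z).hasDerivAt)
        ((hg.intervalIntegrable 0 y).congr_ae (ae_restrict_of_ae h.symm)), add_sub_cancel]
  rw [hftc]
  exact (hg.integral_hasStrictDerivAt 0 x).hasDerivAt.const_add _

namespace IsBackground

variable {s cmin cmax : ℝ} {c : ℝ → ℝ → ℝ}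

theorem continuous_clamped (hc : IsBackground s cmin cmax c) :
    Continuous (Function.uncurry fun t => c (clamp 0 1 t)) :=
  hc.continuousOn.comp_continuous (f := fun z : ℝ × ℝ => (clamp 0 1 z.1, z.2))
    (((continuous_clamp 0 1).comp continuous_fst).prodMk continuous_snd)
    fun z => ⟨(clamp_mem_Icc zero_le_one z.1).1, mem_univ _⟩

theorem continuous_slice (hc : IsBackground s cmin cmax c) {t : ℝ} (ht : 0 ≤ t) :
    Continuous (c t) :=
  hc.continuousOn.comp_continuous (Continuous.prodMk_right t) fun _ => ⟨ht, mem_univ _⟩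

theorem abs_le_cmax (hc : IsBackground s cmin cmax c) {t : ℝ} (ht : 0 ≤ t) (x : ℝ) :
    |c t x| ≤ cmax :=
  (abs_of_nonneg (hc.cmin_pos.le.trans (hc.lower t ht x))).trans_le (hc.upper t ht x)

theorem exists_ae_hasTaylorBound (hs : 2 ≤ s) (hc : IsBackground s cmin cmax c) :
    ∃ L M : ℝ≥0, ∀ᵐ t ∂(volume.restrict (Icc (0 : ℝ) 1)),
      ∃ g, HasTaylorBound L (c t) g ∧ (∀ x, |g x| ≤ L) ∧ eLpNorm g 2 ≤ M := by
  obtain ⟨M, hM⟩ := hc.space_deriv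
  obtain ⟨C, hC⟩ := exists_forall_hasSobolevDerivs 1
  refine ⟨C * M, M, ?_⟩
  filter_upwards [ae_restrict_of_ae_restrict_of_subset Icc_subset_Ici_self hM] with t ⟨hd, hn⟩
  obtain ⟨g, hg⟩ := hC (by norm_num [one_add_one_eq_two, hs]) hn
  have hderiv := hasDerivAt_of_deriv_ae_eq hd (hg.continuous 0 zero_le_one) hg.ae_eq
  refine ⟨g 0, .of_hasDerivAt hderiv (hg.hasDerivAt 0 one_pos) (hg.abs_le 1 le_rfl),
    hg.abs_le 0 zero_le_one, ?_⟩
  rw [← eLpNorm_congr_ae hg.ae_eq]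
  exact (memLp_of_sobolevENorm_le (by linarith) hn).2

theorem exists_spaceDeriv (hs : 2 ≤ s) (hc : IsBackground s cmin cmax c) : ∃ cx : ℝ → ℝ → ℝ,
    BddContinuous cx ∧ (∀ t x, HasDerivAt (c (clamp 0 1 t)) (cx t x) x) ∧ MemLp (cx 0) 2 := by
  obtain ⟨L, M, hae⟩ := hc.exists_ae_hasTaylorBound hs
  have hdense := Icc_subset_closure_of_ae one_pos hae
  have hex (t : ℝ) : ∃ g, HasTaylorBound L (c (clamp 0 1 t)) g ∧ ∀ x, |g x| ≤ L := by
    have ht := clamp_mem_Icc zero_le_one t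
    refine HasTaylorBound.exists_of_mem_closure (hdense ht) (fun x => ?_)
      fun τ ⟨_, g, hg⟩ => ⟨g, hg.1, hg.2.1⟩
    exact (hc.continuousOn (_, x) ⟨ht.1, mem_univ _⟩).comp (f := fun τ => (τ, x))
      (Continuous.prodMk_left x).continuousWithinAt fun τ hτ => ⟨hτ.1.1, mem_univ _⟩
  choose cx hT hL using hex
  have hcx := HasTaylorBound.continuous_uncurry hc.continuous_clamped hT
  refine ⟨cx, ⟨hcx, L, hL⟩, fun t => (hT t).hasDerivAt, (hcx.uncurry_left 0).aestronglyMeasurable,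
    ?_⟩
  obtain ⟨τ, hτ, hτ0⟩ := mem_closure_iff_seq_limit.1 (hdense (left_mem_Icc.2 zero_le_one))
  have hnorm (n : ℕ) : eLpNorm (cx (τ n)) 2 ≤ M := by
    obtain ⟨hmem, g, hg, -, hgM⟩ := hτ n
    rw [← clamp_of_mem hmem] at hg
    rwa [funext fun x => ((hT (τ n)).hasDerivAt x).unique (hg.hasDerivAt x)]
  refine (Lp.eLpNorm_lim_le_liminf_eLpNorm
    (fun n => (hcx.uncurry_left (τ n)).aestronglyMeasurable) (cx 0)
    (Eventually.of_forall fun x => ((hcx.uncurry_right x).tendsto 0).comp hτ0)).trans_lt ?_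
  exact (liminf_le_of_le (by isBoundedDefault) fun b hb =>
    (hb.exists.choose_spec).trans (hnorm _)).trans_lt ENNReal.coe_lt_top

end IsBackground

theorem hasDerivAt_integral_Iic {E : Type*} [NormedAddCommGroup E] [NormedSpace ℝ E]
    [CompleteSpace E] {f : ℝ → E} (hf : Integrable f) (hfc : Continuous f) (x : ℝ) :
    HasDerivAt (fun x => ∫ y in Iic x, f y) (f x) x := by
  have hsplit (z : ℝ) : ∫ y in Iic z, f y = (∫ y in Iic 0, f y) + ∫ y in (0 : ℝ)..z, f y := by
    rw [← intervalIntegral.integral_Iic_sub_Iic hf.integrableOn hf.integrableOn, add_sub_cancel]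
  rw [funext hsplit]
  exact (hfc.integral_hasStrictDerivAt 0 x).hasDerivAt.const_add _

theorem enorm_integral_Iic_le {E : Type*} [NormedAddCommGroup E] [NormedSpace ℝ E] (f : ℝ → E)
    (x : ℝ) : ‖∫ y in Iic x, f y‖ₑ ≤ eLpNorm f 1 := by
  rw [eLpNorm_one_eq_lintegral_enorm]
  exact (enorm_integral_le_lintegral_enorm _).trans (setLIntegral_le_lintegral _ _)

theorem abs_integral_Iic_le {f : ℝ → ℝ} {M : ℝ≥0} (hf : eLpNorm f 1 ≤ M) (x : ℝ) :
    |∫ y in Iic x, f y| ≤ M :=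
  enorm_le_coe.1 ((enorm_integral_Iic_le f x).trans hf)

section IntegralIic

variable {α E : Type*} [MeasurableSpace α] [NormedAddCommGroup E] {μ : Measure α}
  {F : α → ℝ → E} {M : ℝ≥0}

theorem integrable_uncurry_of_ae_eLpNorm_le [IsFiniteMeasure μ]
    (hF : StronglyMeasurable (Function.uncurry F)) (hM : ∀ᵐ τ ∂μ, eLpNorm (F τ) 1 ≤ M) :
    Integrable (Function.uncurry F) (μ.prod volume) := by
  refine ⟨hF.aestronglyMeasurable, ?_⟩
  rw [HasFiniteIntegral, lintegral_prod _ hF.enorm.aemeasurable]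
  calc ∫⁻ τ, (∫⁻ x, ‖F τ x‖ₑ) ∂μ
    _ ≤ ∫⁻ _, M ∂μ := lintegral_mono_ae (hM.mono fun τ hτ => by
      rwa [← eLpNorm_one_eq_lintegral_enorm])
    _ < ⊤ := lintegral_const_lt_top ENNReal.coe_ne_top

variable [NormedSpace ℝ E]

theorem stronglyMeasurable_integral_Iic (hF : StronglyMeasurable (Function.uncurry F)) :
    StronglyMeasurable (Function.uncurry fun τ x => ∫ y in Iic x, F τ y) := by
  have hind : StronglyMeasurable fun w : (α × ℝ) × ℝ => (Iic w.1.2).indicator (F w.1.1) w.2 :=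
    (hF.comp_measurable ((measurable_fst.comp measurable_fst).prodMk measurable_snd)).indicator
      (measurableSet_le measurable_snd (measurable_snd.comp measurable_fst))
  have h := hind.integral_prod_right' (ν := volume)
  simp only [integral_indicator measurableSet_Iic] at h
  exact h

theorem eLpNorm_integral_Iic_integral_le [IsFiniteMeasure μ] {N p : ℝ≥0∞} (hp : 1 ≤ p)
    (hp' : p ≠ ⊤) (hF : StronglyMeasurable (Function.uncurry F))
    (hM : ∀ᵐ τ ∂μ, eLpNorm (F τ) 1 ≤ M)
    (hN : ∀ᵐ τ ∂μ, eLpNorm (fun x => ∫ y in Iic x, F τ y) p ≤ N) :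
    eLpNorm (fun x => ∫ y in Iic x, ∫ τ, F τ y ∂μ) p ≤ μ univ * N := by
  have hswap (x : ℝ) : ∫ y in Iic x, ∫ τ, F τ y ∂μ = ∫ τ, (∫ y in Iic x, F τ y) ∂μ :=
    (integral_integral_swap ((integrable_uncurry_of_ae_eLpNorm_le hF hM).mono_measure
      (Measure.prod_mono le_rfl Measure.restrict_le_self))).symm
  simp only [hswap]
  exact eLpNorm_integral_le_measure_univ_mul hp hp' (stronglyMeasurable_integral_Iic hF) hN

end IntegralIic

theorem integrable_deriv_of_monotone {W : ℝ → ℝ} {C : ℝ} (hW : Monotone W)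
    (hC : ∀ x y, W y - W x ≤ C) : Integrable (deriv W) := by
  have hint (a b : ℝ) : IntervalIntegrable (deriv W) volume a b :=
    (hW.monotoneOn _).intervalIntegrable_deriv
  refine integrable_of_intervalIntegral_norm_bounded (l := atTop (α := ℝ)) C
    (fun n => (hint (-n) n).1) tendsto_neg_atTop_atBot tendsto_id ?_
  filter_upwards [eventually_ge_atTop 0] with n hn
  have hnn : -n ≤ n := neg_le_self hn
  have hle := (hW.monotoneOn (uIcc (-n) n)).intervalIntegral_deriv_mem_uIcc
  rw [uIcc_of_le (sub_nonneg.2 (hW hnn))] at hle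
  simp only [Real.norm_of_nonneg (hW.deriv_nonneg)]
  exact hle.2.trans (hC _ _)

theorem abs_le_of_hasDerivAt_of_abs_sub_le {u W : ℝ → ℝ} {u' W' x : ℝ} (hu : HasDerivAt u u' x)
    (hW : HasDerivAt W W' x) (h : ∀ y, x ≤ y → |u y - u x| ≤ W y - W x) : |u'| ≤ W' := by
  have hIoi : Ioi x ⊆ {x}ᶜ := fun y hy => ne_of_gt hy
  refine le_of_tendsto_of_tendsto
    ((hasDerivAt_iff_tendsto_slope.1 hu).abs.mono_left (nhdsWithin_mono x hIoi))
    ((hasDerivAt_iff_tendsto_slope.1 hW).mono_left (nhdsWithin_mono x hIoi)) ?_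
  filter_upwards [self_mem_nhdsWithin] with y hy
  have hxy : 0 < y - x := sub_pos.2 hy
  rw [slope_def_field, slope_def_field, abs_div, abs_of_pos hxy]
  exact div_le_div_of_nonneg_right (h y hy.le) hxy.le

theorem integrable_of_hasDerivAt_of_boundedVariationOn {u u' : ℝ → ℝ}
    (hu : ∀ x, HasDerivAt u (u' x) x) (hBV : BoundedVariationOn u univ) : Integrable u' := by
  have hloc : LocallyBoundedVariationOn u univ := hBV.locallyBoundedVariationOn
  let W : ℝ → ℝ := variationOnFromTo u univ 0
  have hW : Monotone W := monotoneOn_univ.1 (variationOnFromTo.monotoneOn hloc (mem_univ 0))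
  have hsub (x y : ℝ) (hxy : x ≤ y) : |u y - u x| ≤ W y - W x :=
    variationOnFromTo.abs_sub_le_sub_of_le hloc (mem_univ 0) (mem_univ x) (mem_univ y) hxy
  have hbdd (x y : ℝ) : W y - W x ≤ (eVariationOn u univ).toReal := by
    rw [variationOnFromTo.sub_right hloc (mem_univ 0) (mem_univ y) (mem_univ x)]
    exact (le_abs_self _).trans (variationOnFromTo.abs_le_eVariationOn hBV)
  have hmeas : AEStronglyMeasurable u' := by
    rw [← funext fun x => (hu x).deriv]
    exact (measurable_deriv u).aestronglyMeasurable
  refine (integrable_deriv_of_monotone hW hbdd).mono' hmeas ?_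
  filter_upwards [hW.ae_differentiableAt] with x hx
  exact abs_le_of_hasDerivAt_of_abs_sub_le (hu x) hx.hasDerivAt (hsub x)

theorem lipschitzWith_clamp (a b : ℝ) : LipschitzWith 1 (clamp a b) :=
  (LipschitzWith.id.const_min b).const_max a

theorem edist_clamp_zero_le_one (t : ℝ) : edist (clamp 0 1 t) 0 ≤ 1 := by
  have ht := clamp_mem_Icc zero_le_one t
  rw [edist_dist, Real.dist_0_eq_abs, abs_of_nonneg ht.1]
  exact ENNReal.ofReal_le_one.2 ht.2

namespace IsBackground

variable {s cmin cmax : ℝ} {c : ℝ → ℝ → ℝ}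

theorem exists_time_bounds (hs : 1 ≤ s) (hc : IsBackground s cmin cmax c) : ∃ M : ℝ≥0,
    (∀ t, 0 ≤ t → ∀ t', 0 ≤ t' → eLpNorm (fun x => c t x - c t' x) 1 ≤ edist t t' * M) ∧
      ∀ t, 0 ≤ t → eLpNorm (fun x => ∫ y in Iic x, (c t y - c 0 y)) 2 ≤ edist t 0 * M := by
  obtain ⟨ct, hm, hint, M, hM⟩ := hc.time_deriv
  have hsub {t t' : ℝ} (ht : 0 ≤ t) (ht' : 0 ≤ t') :
      ∀ᵐ x, c t x - c t' x = ∫ τ in t'..t, ct τ x := by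
    filter_upwards [hint t ht, hint t' ht'] with x ⟨hi, hx⟩ ⟨hi', hx'⟩
    rw [hx, hx', add_sub_add_left_eq_sub, intervalIntegral.integral_interval_sub_left hi hi']
  have hM' {t t' : ℝ} (ht : 0 ≤ t) (ht' : 0 ≤ t') := ae_restrict_of_ae_restrict_of_subset
    ((uIoc_subset_uIcc (a := t') (b := t)).trans fun τ hτ => (le_inf ht' ht).trans hτ.1) hM
  have hvol (t t' : ℝ) : volume.restrict (Ι t' t) univ = edist t t' := by
    rw [Measure.restrict_apply_univ, Real.volume_uIoc, edist_dist, Real.dist_eq]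
  refine ⟨M, fun t ht t' ht' => ?_, fun t ht => ?_⟩
  · rw [eLpNorm_congr_norm_ae (g := fun x => ∫ τ in Ι t' t, ct τ x)
      ((hsub ht ht').mono fun x hx => by
        rw [hx, intervalIntegral.norm_intervalIntegral_eq]), ← hvol]
    exact eLpNorm_integral_le_measure_univ_mul le_rfl ENNReal.one_ne_top hm.stronglyMeasurable
      ((hM' ht ht').mono fun τ hτ => hτ.2.2)
  · have hB (x : ℝ) : ∫ y in Iic x, (c t y - c 0 y) = ∫ y in Iic x, ∫ τ in Ι 0 t, ct τ y :=
      integral_congr_ae (ae_restrict_of_ae ((hsub ht le_rfl).mono fun y hy =>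
        hy.trans (by rw [intervalIntegral.integral_of_le ht, uIoc_of_le ht])))
    have : IsFiniteMeasure (volume.restrict (Ι 0 t)) := ⟨by
      rw [hvol]; exact edist_lt_top _ _⟩
    rw [funext hB, ← hvol]
    refine eLpNorm_integral_Iic_integral_le one_le_two ENNReal.ofNat_ne_top hm.stronglyMeasurable
      ((hM' ht le_rfl).mono fun τ hτ => hτ.2.2) ((hM' ht le_rfl).mono fun τ hτ => ?_)
    have hi : Integrable (ct τ) := memLp_one_iff_integrable.1
      ⟨(hm.comp measurable_prodMk_left).aestronglyMeasurable,
        hτ.2.2.trans_lt ENNReal.coe_lt_top⟩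
    exact (memLp_integral_Iic_of_homSobolev hs hi (hτ.1.trans_lt ENNReal.coe_lt_top) hτ.2.1).2

theorem bddInLp_clamped_sub (hs : 1 ≤ s) (hc : IsBackground s cmin cmax c) :
    BddInLp 1 fun t x => c (clamp 0 1 t) x - c 0 x := by
  obtain ⟨M, hM, -⟩ := hc.exists_time_bounds hs
  refine ⟨hc.continuous_clamped.sub ((hc.continuous_slice le_rfl).comp continuous_snd), M,
    fun t => (hM _ (clamp_mem_Icc zero_le_one t).1 _ le_rfl).trans ?_⟩
  exact mul_le_of_le_one_left' (edist_clamp_zero_le_one t)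

theorem hasDerivAt_integral_Iic_clamped_sub (hs : 1 ≤ s) (hc : IsBackground s cmin cmax c)
    (t x : ℝ) : HasDerivAt (fun x => ∫ y in Iic x, (c (clamp 0 1 t) y - c 0 y))
      (c (clamp 0 1 t) x - c 0 x) x :=
  have h := hc.bddInLp_clamped_sub hs
  hasDerivAt_integral_Iic (memLp_one_iff_integrable.1 (h.memLp t)) (h.continuous_slice t) x

theorem continuous_integral_Iic_clamped_sub (hs : 1 ≤ s) (hc : IsBackground s cmin cmax c) :
    Continuous (Function.uncurry fun t x => ∫ y in Iic x, (c (clamp 0 1 t) y - c 0 y)) := by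
  obtain ⟨M, hM, -⟩ := hc.exists_time_bounds hs
  have hint (t : ℝ) : Integrable fun y => c (clamp 0 1 t) y - c 0 y :=
    memLp_one_iff_integrable.1 ((hc.bddInLp_clamped_sub hs).memLp t)
  refine continuous_prod_of_continuous_lipschitzWith _ M
    (fun t => continuous_of_hasDerivAt (hc.hasDerivAt_integral_Iic_clamped_sub hs t))
    fun x t t' => ?_
  have hsub : (∫ y in Iic x, (c (clamp 0 1 t) y - c 0 y)) -
      ∫ y in Iic x, (c (clamp 0 1 t') y - c 0 y) =
        ∫ y in Iic x, (c (clamp 0 1 t) y - c (clamp 0 1 t') y) := by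
    rw [← integral_sub (hint t).integrableOn (hint t').integrableOn]
    simp only [sub_sub_sub_cancel_right]
  simp only [Function.uncurry_apply_pair, edist_eq_enorm_sub, hsub]
  calc ‖∫ y in Iic x, (c (clamp 0 1 t) y - c (clamp 0 1 t') y)‖ₑ
    _ ≤ edist (clamp 0 1 t) (clamp 0 1 t') * M := (enorm_integral_Iic_le _ x).trans
      (hM _ (clamp_mem_Icc zero_le_one t).1 _ (clamp_mem_Icc zero_le_one t').1)
    _ ≤ M * edist t t' := by
      rw [mul_comm]
      gcongr
      simpa using lipschitzWith_clamp 0 1 t t'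

theorem bddContinuous_integral_Iic_clamped_sub (hs : 1 ≤ s) (hc : IsBackground s cmin cmax c) :
    BddContinuous fun t x => ∫ y in Iic x, (c (clamp 0 1 t) y - c 0 y) := by
  obtain ⟨M, hM⟩ := (hc.bddInLp_clamped_sub hs).bounded
  exact ⟨hc.continuous_integral_Iic_clamped_sub hs, M, fun t => abs_integral_Iic_le (hM t)⟩

theorem bddInLp_integral_Iic_clamped_sub (hs : 1 ≤ s) (hc : IsBackground s cmin cmax c) :
    BddInLp 2 fun t x => ∫ y in Iic x, (c (clamp 0 1 t) y - c 0 y) := by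
  obtain ⟨M, -, hM⟩ := hc.exists_time_bounds hs
  refine ⟨hc.continuous_integral_Iic_clamped_sub hs, M,
    fun t => (hM _ (clamp_mem_Icc zero_le_one t).1).trans ?_⟩
  exact mul_le_of_le_one_left' (edist_clamp_zero_le_one t)

end IsBackground

theorem HasSobolevDerivs.bddContinuous {n j : ℕ} {C : ℝ} {f : ℝ → ℝ} {g : ℕ → ℝ → ℝ}
    (h : HasSobolevDerivs n C f g) (hj : j ≤ n) : BddContinuous fun _ => g j :=
  ⟨(h.continuous j hj).comp continuous_snd, C, fun _ => h.abs_le j hj⟩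

theorem exists_hasSobolevDerivs_of_continuous {n : ℕ} {s : ℝ} {f : ℝ → ℝ} (hs : n + 1 ≤ s)
    (hf : Continuous f) (hfs : sobolevENorm s f < ⊤) :
    ∃ (C : ℝ) (g : ℕ → ℝ → ℝ), g 0 = f ∧ HasSobolevDerivs n C f g := by
  obtain ⟨C, hC⟩ := exists_forall_hasSobolevDerivs n
  obtain ⟨g, hg⟩ := hC hs (ENNReal.coe_toNNReal hfs.ne).ge
  exact ⟨_, g, ((hg.continuous 0 n.zero_le).ae_eq_iff_eq volume hf).1 hg.ae_eq.symm, hg⟩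

theorem bddContinuous_integral_Iic {f : ℝ → ℝ} (hf : Integrable f) (hfc : Continuous f) :
    BddContinuous fun _ x => ∫ y in Iic x, f y where
  continuous := (continuous_of_hasDerivAt (hasDerivAt_integral_Iic hf hfc)).comp continuous_snd
  bounded := ⟨_, fun _ => abs_integral_Iic_le
    (ENNReal.coe_toNNReal (memLp_one_iff_integrable.2 hf).eLpNorm_ne_top).ge⟩

theorem hasDerivAt_intervalIntegral_add {b f P : ℝ → ℝ} {x : ℝ} (hb : Continuous b)
    (hP : HasDerivAt P (f x - b x) x) : HasDerivAt (fun x => (∫ y in 0..x, b y) + P x) (f x) x :=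
  ((hb.integral_hasStrictDerivAt 0 x).hasDerivAt.add hP).congr_deriv (add_sub_cancel _ _)

section InitialData

variable {s cmin cmax : ℝ} {c : ℝ → ℝ → ℝ} {ρ₀ u₀ : ℝ → ℝ}

theorem exists_velocity_derivs (hs : 2 ≤ s) (hu₀ : Continuous u₀)
    (hu₀_Hs : sobolevENorm (s + 1) u₀ < ⊤) (hu₀_BV : BoundedVariationOn u₀ univ) :
    ∃ u₁ u₂ : ℝ → ℝ, (∀ x, HasDerivAt u₀ (u₁ x) x) ∧ (∀ x, HasDerivAt u₁ (u₂ x) x) ∧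
      BddContinuous (fun _ => u₀) ∧ BddContinuous (fun _ => u₁) ∧ BddContinuous (fun _ => u₂) ∧
      MemLp u₀ 2 ∧ Integrable u₁ := by
  obtain ⟨_, v, rfl, hv⟩ := exists_hasSobolevDerivs_of_continuous (n := 2)
    (by norm_num; linarith) hu₀ hu₀_Hs
  exact ⟨v 1, v 2, hv.hasDerivAt 0 two_pos, hv.hasDerivAt 1 one_lt_two,
    hv.bddContinuous zero_le_two, hv.bddContinuous one_le_two, hv.bddContinuous le_rfl,
    (memLp_of_sobolevENorm_le (by linarith) (ENNReal.coe_toNNReal hu₀_Hs.ne).ge).1,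
    integrable_of_hasDerivAt_of_boundedVariationOn (hv.hasDerivAt 0 two_pos) hu₀_BV⟩

theorem exists_density_deriv {c₀ c₁ : ℝ → ℝ} (hs : 2 ≤ s) (hρ₀ : Continuous ρ₀)
    (hc₀ : ∀ x, HasDerivAt c₀ (c₁ x) x) (hc₀_bdd : BddContinuous fun _ => c₀)
    (hc₁_bdd : BddContinuous fun _ => c₁) (hρ₀_Hs : sobolevENorm s (fun x => ρ₀ x - c₀ x) < ⊤) :
    ∃ ρ₁ : ℝ → ℝ, (∀ x, HasDerivAt ρ₀ (ρ₁ x) x) ∧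
      BddContinuous (fun _ => ρ₀) ∧ BddContinuous fun _ => ρ₁ := by
  obtain ⟨_, g, hg0, hg⟩ := exists_hasSobolevDerivs_of_continuous (n := 1)
    (by norm_num; linarith) (hρ₀.sub (continuous_of_hasDerivAt hc₀)) hρ₀_Hs
  obtain rfl : ρ₀ = fun x => g 0 x + c₀ x := by ext x; rw [hg0, Pi.sub_apply, sub_add_cancel]
  exact ⟨fun x => g 1 x + c₁ x, fun x => (hg.hasDerivAt 0 one_pos x).add (hc₀ x),
    (hg.bddContinuous zero_le_one).add hc₀_bdd, (hg.bddContinuous le_rfl).add hc₁_bdd⟩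

theorem exists_common_bound {f : ℝ → ℝ → ℝ} {g h : ℝ → ℝ} (hf : BddContinuous f)
    (hg : BddContinuous fun _ => g) (hh : BddContinuous fun _ => h) :
    ∃ κ : ℝ≥0, (∀ t x, |f t x| ≤ κ) ∧ (∀ x, |g x| ≤ κ) ∧ ∀ x, |h x| ≤ κ := by
  obtain ⟨A, hA⟩ := hf.bounded
  obtain ⟨B, hB⟩ := hg.bounded
  obtain ⟨C, hC⟩ := hh.bounded
  have hle : max A (max B C) ≤ (max A (max B C)).toNNReal := Real.le_coe_toNNReal _
  simp only [max_le_iff] at hle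
  exact ⟨_, fun t x => (hA t x).trans hle.1, fun x => (hB 0 x).trans hle.2.1,
    fun x => (hC 0 x).trans hle.2.2⟩

theorem exists_field_primitives (hs : 1 ≤ s) (hc : IsBackground s cmin cmax c)
    (hρ₀ : Continuous ρ₀) (hρ₀_Hs : sobolevENorm s (fun x => ρ₀ x - c 0 x) < ⊤)
    (hρ₀_Hneg : homSobolevNegOneENorm (fun x => ρ₀ x - c 0 x) < ⊤)
    (hρ₀_L1 : Integrable (fun x => ρ₀ x - c 0 x)) : ∃ (Γ : ℝ → ℝ → ℝ) (m : ℝ → ℝ),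
      (∀ t x, HasDerivAt (Γ t) (c (clamp 0 1 t) x) x) ∧ (∀ x, HasDerivAt m (ρ₀ x) x) ∧
      BddContinuous (fun t x => Γ t x - m x) ∧ BddInLp 2 fun t x => Γ t x - m x := by
  have hc₀ := hc.continuous_slice le_rfl
  have hsub : Continuous fun x => ρ₀ x - c 0 x := hρ₀.sub hc₀
  have hP_bdd := bddContinuous_integral_Iic hρ₀_L1 hsub
  have hP_L2 := (memLp_integral_Iic_of_homSobolev hs hρ₀_L1 hρ₀_Hs
    (ENNReal.coe_toNNReal hρ₀_Hneg.ne).ge).1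
  refine ⟨fun t x => (∫ y in 0..x, c 0 y) + ∫ y in Iic x, (c (clamp 0 1 t) y - c 0 y),
    fun x => (∫ y in 0..x, c 0 y) + ∫ y in Iic x, (ρ₀ y - c 0 y),
    fun t x => hasDerivAt_intervalIntegral_add hc₀ (hc.hasDerivAt_integral_Iic_clamped_sub hs t x),
    fun x => hasDerivAt_intervalIntegral_add hc₀ (hasDerivAt_integral_Iic hρ₀_L1 hsub x), ?_⟩
  simp only [add_sub_add_left_eq_sub]
  exact ⟨(hc.bddContinuous_integral_Iic_clamped_sub hs).sub hP_bdd,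
    (hc.bddInLp_integral_Iic_clamped_sub hs).sub one_le_two
      (.of_memLp (hP_bdd.continuous_slice 0) hP_L2)⟩

theorem exists_lagrangianData (hs : 2 ≤ s) (hc : IsBackground s cmin cmax c)
    (hρ₀ : Continuous ρ₀) (hu₀ : Continuous u₀)
    (hρ₀_Hs : sobolevENorm s (fun x => ρ₀ x - c 0 x) < ⊤)
    (hρ₀_Hneg : homSobolevNegOneENorm (fun x => ρ₀ x - c 0 x) < ⊤)
    (hρ₀_L1 : Integrable (fun x => ρ₀ x - c 0 x))
    (hu₀_Hs : sobolevENorm (s + 1) u₀ < ⊤) (hu₀_BV : BoundedVariationOn u₀ univ) :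
    ∃ d : LagrangianData, d.ρ₀ = ρ₀ ∧ d.u₀ = u₀ ∧ ∀ t, d.c t = c (clamp 0 1 t) := by
  have hs1 : 1 ≤ s := by linarith
  have hclamp : clamp 0 1 0 = 0 := clamp_of_mem (left_mem_Icc.2 zero_le_one)
  have hc_bdd : BddContinuous fun t => c (clamp 0 1 t) :=
    ⟨hc.continuous_clamped, _, fun t => hc.abs_le_cmax (clamp_mem_Icc zero_le_one t).1⟩
  obtain ⟨cx, hcx_bdd, hcx, hcx_L2⟩ := hc.exists_spaceDeriv hs
  obtain ⟨Γ, m, hΓ, hm, hfield_bdd, hfield_L2⟩ :=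
    exists_field_primitives hs1 hc hρ₀ hρ₀_Hs hρ₀_Hneg hρ₀_L1
  have hcx₀ : ∀ x, HasDerivAt (c 0) (cx 0 x) x := by simpa only [hclamp] using hcx 0
  obtain ⟨ρ₁, hρ₁, hρ₀_bdd, hρ₁_bdd⟩ := exists_density_deriv hs hρ₀ hcx₀
    (hclamp ▸ hc_bdd.slice 0) (hcx_bdd.slice 0) hρ₀_Hs
  obtain ⟨u₁, u₂, hu₁, hu₂, hu₀_bdd, hu₁_bdd, hu₂_bdd, hu₀_L2, hu₁_L1⟩ :=
    exists_velocity_derivs hs hu₀ hu₀_Hs hu₀_BV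
  have hρ₀_sub : BddInLp 1 fun _ x => ρ₀ x - c 0 x :=
    .of_memLp (hρ₀.sub (hc.continuous_slice le_rfl)) (memLp_one_iff_integrable.2 hρ₀_L1)
  have hc_sub : BddInLp 1 fun t x => c (clamp 0 1 t) x - ρ₀ x := by
    simpa only [sub_sub_sub_cancel_right] using (hc.bddInLp_clamped_sub hs1).sub le_rfl hρ₀_sub
  obtain ⟨κ, hc_le, hρ₀_le, hu₁_le⟩ := exists_common_bound hc_bdd hρ₀_bdd hu₁_bdd
  exact ⟨⟨Γ, fun t => c (clamp 0 1 t), cx, m, ρ₀, ρ₁, u₀, u₁, u₂, κ, hΓ, hcx, hm, hρ₁, hu₁, hu₂,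
    hc.continuous_clamped, hc_le, hρ₀_le, hu₁_le, hcx_bdd, hρ₁_bdd, hu₀_bdd, hu₂_bdd, hfield_bdd,
    hfield_L2, hc_sub, .of_memLp (hcx_bdd.continuous_slice 0) hcx_L2, .of_memLp hu₀ hu₀_L2,
    .of_memLp (hu₁_bdd.continuous_slice 0) (memLp_one_iff_integrable.2 hu₁_L1)⟩,
    rfl, rfl, fun _ => rfl⟩

end InitialData

theorem theorem1p3_general (s : ℝ) (hs : 2 ≤ s) (k ν : ℝ)
    (cmin cmax : ℝ) (c : ℝ → ℝ → ℝ) (hc : IsBackground s cmin cmax c)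
    (ρ₀ u₀ : ℝ → ℝ) (hρ₀_cont : Continuous ρ₀) (hu₀_cont : Continuous u₀)
    (hρ₀_Hs : sobolevENorm s (fun x => ρ₀ x - c 0 x) < ⊤)
    (hρ₀_Hneg : homSobolevNegOneENorm (fun x => ρ₀ x - c 0 x) < ⊤)
    (hρ₀_L1 : Integrable (fun x => ρ₀ x - c 0 x))
    (hu₀_Hs : sobolevENorm (s + 1) u₀ < ⊤)
    (hu₀_BV : BoundedVariationOn u₀ univ) :
    ∃ T : ℝ, 0 < T ∧ ∃ ρ u : ℝ → ℝ → ℝ,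
      IsClassicalSolution k ν c ρ₀ u₀ T ρ u ∧
      (⨆ t ∈ Ico (0 : ℝ) T,
        (eLpNorm (fun x => ρ t x - c t x) 1 + eLpNorm (spaceDeriv u t) 1)) < ⊤ := by
  obtain ⟨d, rfl, rfl, hdc⟩ := exists_lagrangianData hs hc hρ₀_cont hu₀_cont hρ₀_Hs hρ₀_Hneg
    hρ₀_L1 hu₀_Hs hu₀_BV
  obtain ⟨T, hT, hT1, hKT⟩ : ∃ T : ℝ, 0 < T ∧ T ≤ 1 ∧ d.rate k ν * T ≤ 1 / 2 := by
    have hK : (0 : ℝ) ≤ d.rate k ν := NNReal.coe_nonneg _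
    refine ⟨1 / (2 * (d.rate k ν + 1)), by positivity, ?_, ?_⟩
    · rw [div_le_one (by positivity)]; linarith [hK]
    · rw [mul_one_div, div_le_div_iff₀ (by positivity) two_pos]; linarith
  obtain ⟨p⟩ := d.nonempty_particleFlow hT hKT
  have hdc_eq (t : ℝ) (ht : t ∈ Ico 0 T) : d.c t = c t := by
    rw [hdc, clamp_of_mem ⟨ht.1, ht.2.le.trans hT1⟩]
  refine ⟨T, hT, p.density, p.velocity, p.isClassicalSolution.congr_background hdc_eq, ?_⟩
  convert p.iSup_eLpNorm_lt_top using 4 with t ht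
  rw [hdc_eq t ht]

theorem theorem1p3 (s : ℝ) (hs : 2 ≤ s) (k ν : ℝ) (hk : k = 1 ∨ k = -1) (hν : 0 ≤ ν)
    (cmin cmax : ℝ) (c : ℝ → ℝ → ℝ) (hc : IsBackground s cmin cmax c)
    (ρ₀ u₀ : ℝ → ℝ) (hρ₀_cont : Continuous ρ₀) (hu₀_cont : Continuous u₀)
    (hρ₀_Hs : sobolevENorm s (fun x => ρ₀ x - c 0 x) < ⊤)
    (hρ₀_Hneg : homSobolevNegOneENorm (fun x => ρ₀ x - c 0 x) < ⊤)
    (hρ₀_L1 : Integrable (fun x => ρ₀ x - c 0 x) volume)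
    (hu₀_Hs : sobolevENorm (s + 1) u₀ < ⊤)
    (hu₀_BV : BoundedVariationOn u₀ univ) :
    ∃ T : ℝ, 0 < T ∧ ∃ ρ u : ℝ → ℝ → ℝ,
      IsClassicalSolution k ν c ρ₀ u₀ T ρ u ∧
      (⨆ t ∈ Ico (0 : ℝ) T,
        (eLpNorm (fun x => ρ t x - c t x) 1 volume + eLpNorm (spaceDeriv u t) 1 volume)) < ⊤ :=
  theorem1p3_general s hs k ν cmin cmax c hc ρ₀ u₀ hρ₀_cont hu₀_cont hρ₀_Hs hρ₀_Hneg hρ₀_L1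
    hu₀_Hs hu₀_BV
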